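/- Let $M_n$ be a random $n\times n$ matrix whose entries are independent and each equal to $1$ or $-1$ with probability $1/2$ (equivalently, $M_n$ is uniformly distributed over all $n\times n$ $\pm1$ matrices). Let $h(x) := x\log_2\frac1x+(1-x)\log_2\frac1{1-x}$ for $0<x<1$. The equation $$h(\varepsilon)+\frac{\varepsilon}{\log_2(16/15)}=1$$ has exactly one solution $\varepsilon$ in the interval $(0,1/2)$; it satisfies $0.06191\le\varepsilon<0.06192$, and $$\mathbf P(\det M_n=0)\le(1-\varepsilon+o(1))^n ,$$ where $o(1)$ denotes a quantity depending only on $n$ that tends to $0$ as $n\to\infty$. In particular, $\mathbf P(\det M_n=0)\le 0.939^n$ for all sufficiently large $n$. -/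

import Mathlib

open Filter Topology ProbabilityTheory

/-- The set of `n × n` real matrices, as arrays of entries, all of whose entries
are `1` or `-1`. -/
def signMatrices (n : ℕ) : Set (Fin n → Fin n → ℝ) :=
  {A | ∀ i j, A i j = 1 ∨ A i j = -1}

/-- The probability that an `n × n` matrix drawn uniformly at random from the `±1` matrices
(equivalently, with independent entries, each `1` or `-1` with probability `1/2`)
is singular. -/
noncomputable def singularProb (n : ℕ) : ℝ :=
  (uniformOn (signMatrices n)).real {A | (Matrix.of A).det = 0}

/-- The binary entropy function, with logarithms to base `2`. -/
noncomputable def entropy (x : ℝ) : ℝ :=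
  x * Real.logb 2 (1 / x) + (1 - x) * Real.logb 2 (1 / (1 - x))

/-- `x` lies in `(0, 1/2)` and solves `h(x) + x / log₂ (16/15) = 1`. -/
def IsEntropySolution (x : ℝ) : Prop :=
  0 < x ∧ x < 1 / 2 ∧ entropy x + x / Real.logb 2 (16 / 15) = 1

/-! The entropy equation serves only to locate ε: as ε < 0.06192, one has 0.938 < 1 - ε, and
everything follows from `eventually_singularProb_le`, whose proof gives 3n(15/16)^n for large n.

If an n × n sign matrix is singular, some row lies in the span of the others, hence is orthogonal to
any kernel vector v of those n - 1 rows. So the probability is at most n times the mean of q =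
`signProb v` (`singularProb_succ_le_avg`). Siegel's lemma gives an integral v with entries at most
n^(n-1), not all divisible by 3. The case q ≤ (15/16)^n is harmless. If v has at most n/50 nonzero
entries, there is a sparse kernel vector modulo 3, which a union bound makes unlikely. Otherwise
Littlewood–Offord gives q ≤ n^(-0.45). With Q = n^1.02, averaging over primes yields p between Q/q
and 4Q/q such that a = v mod p has p · `signProb a` in [Q, 8Q].

It remains to count such a. By Fourier inversion p · `signProb a` is at most a sum over t of the
products of `lazyCos (t * a i)`. Taking a k-th moment, k = n/100, over distinct t_1, ..., t_k and
summing over a exchanges the roles of a and t: the count is controlled by p^n times the sum of n-th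
powers of return probabilities of lazy walks with steps t_j (`sum_ind_mul_pow_le`). A Halász
argument through Cauchy–Davenport bounds each return probability by n^(-1.45)
(`lazyProb_le_of_injective`). The sum is an expected number of t orthogonal to n random rows, and
Odlyzko's bound, applied row by row, makes it at most 2^n n^(-1.45 · 0.73n), up to rounding
(`sum_walkProb_pow_le`). Since 1.45 · 0.73 > 1.02, this beats the factor (8Q)^(n-1) left by the
orthogonality conditions. -/

/-- The indicator of a proposition, as a real number. -/
noncomputable def ind (P : Prop) : ℝ := by
  classical exact if P then 1 else 0

lemma ind_of_true {P : Prop} (h : P) : ind P = 1 := by simp [ind, h]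

lemma ind_of_false {P : Prop} (h : ¬ P) : ind P = 0 := by simp [ind, h]

lemma ind_nonneg (P : Prop) : 0 ≤ ind P := by
  by_cases h : P <;> simp [ind, h]

lemma ind_le_one (P : Prop) : ind P ≤ 1 := by
  by_cases h : P <;> simp [ind, h]

lemma ind_mono {P Q : Prop} (h : P → Q) : ind P ≤ ind Q := by
  by_cases hP : P
  · rw [ind_of_true hP, ind_of_true (h hP)]
  · rw [ind_of_false hP]; exact ind_nonneg Q

lemma ind_congr {P Q : Prop} (h : P ↔ Q) : ind P = ind Q := by rw [propext h]

lemma ind_and (P Q : Prop) : ind (P ∧ Q) = ind P * ind Q := by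
  by_cases hP : P <;> by_cases hQ : Q <;> simp [ind, hP, hQ]

lemma ind_forall {ι : Type*} [Fintype ι] (P : ι → Prop) : ind (∀ i, P i) = ∏ i, ind (P i) := by
  by_cases h : ∀ i, P i
  · rw [ind_of_true h]
    exact (Finset.prod_eq_one fun i _ => ind_of_true (h i)).symm
  · rw [ind_of_false h]
    push Not at h
    obtain ⟨i, hi⟩ := h
    exact (Finset.prod_eq_zero (Finset.mem_univ i) (ind_of_false hi)).symm

lemma ind_exists_le {ι : Type*} (s : Finset ι) (P : ι → Prop) :
    ind (∃ i ∈ s, P i) ≤ ∑ i ∈ s, ind (P i) := by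
  by_cases h : ∃ i ∈ s, P i
  · obtain ⟨i, hi, hP⟩ := h
    rw [ind_of_true ⟨i, hi, hP⟩, ← ind_of_true hP]
    exact Finset.single_le_sum (f := fun i => ind (P i)) (fun i _ => ind_nonneg _) hi
  · rw [ind_of_false h]
    exact Finset.sum_nonneg fun i _ => ind_nonneg _

/-- The average of a function on a finite type. -/
noncomputable def avg {Ω : Type*} [Fintype Ω] (f : Ω → ℝ) : ℝ :=
  (∑ ω, f ω) / Fintype.card Ω

section avg
variable {Ω Ω' : Type*} [Fintype Ω] [Fintype Ω']

lemma avg_mono {f g : Ω → ℝ} (h : ∀ ω, f ω ≤ g ω) : avg f ≤ avg g := by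
  unfold avg
  gcongr
  exact h _

lemma avg_nonneg {f : Ω → ℝ} (h : ∀ ω, 0 ≤ f ω) : 0 ≤ avg f := by
  unfold avg
  have := Finset.sum_nonneg fun ω (_ : ω ∈ Finset.univ) => h ω
  positivity

lemma avg_add (f g : Ω → ℝ) : avg (fun ω => f ω + g ω) = avg f + avg g := by
  simp [avg, Finset.sum_add_distrib, add_div]

lemma avg_sum {ι : Type*} (s : Finset ι) (f : ι → Ω → ℝ) :
    avg (fun ω => ∑ i ∈ s, f i ω) = ∑ i ∈ s, avg (f i) := by
  simp only [avg]
  rw [Finset.sum_comm, Finset.sum_div]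

lemma avg_mul_left (r : ℝ) (f : Ω → ℝ) : avg (fun ω => r * f ω) = r * avg f := by
  simp only [avg]
  rw [← Finset.mul_sum, mul_div_assoc]

lemma avg_mul_right (f : Ω → ℝ) (r : ℝ) : avg (fun ω => f ω * r) = avg f * r := by
  simp_rw [mul_comm _ r]
  exact avg_mul_left r f

lemma avg_const [Nonempty Ω] (r : ℝ) : avg (fun _ : Ω => r) = r := by
  simp [avg]

lemma avg_le_of_le [Nonempty Ω] {f : Ω → ℝ} {r : ℝ} (h : ∀ ω, f ω ≤ r) : avg f ≤ r :=
  (avg_mono h).trans_eq (avg_const r)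

lemma avg_equiv (e : Ω ≃ Ω') (f : Ω' → ℝ) : avg (fun ω => f (e ω)) = avg f := by
  simp only [avg]
  rw [Equiv.sum_comp e f, Fintype.card_congr e]

lemma avg_prod (f : Ω × Ω' → ℝ) : avg f = avg (fun ω => avg fun ω' => f (ω, ω')) := by
  simp only [avg]
  rw [Fintype.sum_prod_type, ← Finset.sum_div, div_div, Fintype.card_prod, Nat.cast_mul,
    mul_comm]

lemma avg_comm (f : Ω → Ω' → ℝ) :
    avg (fun ω => avg fun ω' => f ω ω') = avg (fun ω' => avg fun ω => f ω ω') := by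
  simp only [avg]
  rw [← Finset.sum_div, ← Finset.sum_div, Finset.sum_comm, div_right_comm]

lemma avg_pi {ι : Type*} [Fintype ι] [DecidableEq ι] (f : ι → Ω → ℝ) :
    avg (fun x : ι → Ω => ∏ i, f i (x i)) = ∏ i, avg (f i) := by
  simp only [avg]
  rw [Finset.prod_div_distrib, Finset.prod_univ_sum, Fintype.piFinset_univ]
  simp

end avg

/-! ### Return probabilities of random walks -/

/-- The probability that `∑ i, f (x i) * a i = 0`, where the `x i` are independent and uniform. -/
noncomputable def walkProb {Ω ι R : Type*} [Fintype Ω] [Fintype ι] [DecidableEq ι] [CommRing R]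
    (f : Ω → R) (a : ι → R) : ℝ :=
  avg fun x : ι → Ω => ind (∑ i, f (x i) * a i = 0)

/-- The probability that the inner product of `a` with a random sign vector vanishes. -/
noncomputable def signProb {ι R : Type*} [Fintype ι] [DecidableEq ι] [CommRing R] (a : ι → R) : ℝ :=
  walkProb (fun ε : ℤˣ => ((ε : ℤ) : R)) a

lemma walkProb_nonneg {Ω ι R : Type*} [Fintype Ω] [Fintype ι] [DecidableEq ι] [CommRing R]
    (f : Ω → R) (a : ι → R) : 0 ≤ walkProb f a :=
  avg_nonneg fun _ => ind_nonneg _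

lemma walkProb_le_one {Ω ι R : Type*} [Fintype Ω] [Nonempty Ω] [Fintype ι] [DecidableEq ι] [CommRing R]
    (f : Ω → R) (a : ι → R) : walkProb f a ≤ 1 :=
  avg_le_of_le fun _ => ind_le_one _

/-- The probability that all rows of a random matrix are orthogonal to `a`. -/
lemma avg_ind_forall {Ω κ : Type*} [Fintype Ω] [Fintype κ] [DecidableEq κ] (P : Ω → Prop) :
    avg (fun B : κ → Ω => ind (∀ l, P (B l))) = (avg fun ω => ind (P ω)) ^ Fintype.card κ := by
  simp_rw [ind_forall]
  rw [avg_pi (fun _ ω => ind (P ω))]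
  simp

/-! ### Fourier analysis on `ZMod p` -/

section Fourier
variable {p : ℕ} [Fact p.Prime]

/-- The cosine on `ZMod p`. -/
noncomputable def zcos (s : ZMod p) : ℝ := (ZMod.stdAddChar s : ℂ).re

/-- The Fourier transform of the lazy step. -/
noncomputable def lazyCos (s : ZMod p) : ℝ := (1 + zcos s ^ 2) / 2

lemma norm_stdAddChar (s : ZMod p) : ‖(ZMod.stdAddChar s : ℂ)‖ = 1 := by
  simp

lemma stdAddChar_neg (s : ZMod p) :
    (ZMod.stdAddChar (-s) : ℂ) = (starRingEnd ℂ) (ZMod.stdAddChar s) := by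
  rw [AddChar.map_neg_eq_conj]

lemma abs_zcos_le_one (s : ZMod p) : |zcos s| ≤ 1 :=
  (Complex.abs_re_le_norm _).trans_eq (norm_stdAddChar s)

/-- AM–GM. The majorant is nonnegative and is itself the transform of a step distribution. -/
lemma abs_zcos_le_lazyCos (s : ZMod p) : |zcos s| ≤ lazyCos s := by
  unfold lazyCos
  nlinarith [sq_nonneg (|zcos s| - 1), sq_abs (zcos s)]

lemma lazyCos_nonneg (s : ZMod p) : 0 ≤ lazyCos s := by unfold lazyCos; positivity

lemma lazyCos_le_one (s : ZMod p) : lazyCos s ≤ 1 := by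
  unfold lazyCos
  nlinarith [abs_zcos_le_one s, abs_nonneg (zcos s), sq_abs (zcos s)]

lemma stdAddChar_sum {ι : Type*} (s : Finset ι) (f : ι → ZMod p) :
    (ZMod.stdAddChar (∑ i ∈ s, f i) : ℂ) = ∏ i ∈ s, (ZMod.stdAddChar (f i) : ℂ) := by
  classical
  induction s using Finset.induction_on with
  | empty => simp
  | insert i s hi ih => rw [Finset.sum_insert hi, Finset.prod_insert hi, AddChar.map_add_eq_mul, ih]

lemma ind_eq_sum_stdAddChar (s : ZMod p) :
    (p : ℂ) * (ind (s = 0) : ℝ) = ∑ t : ZMod p, (ZMod.stdAddChar (t * s) : ℂ) := by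
  rw [AddChar.sum_mulShift s (ZMod.isPrimitive_stdAddChar p)]
  by_cases h : s = 0 <;> simp [ind, h, ZMod.card]

/-- Expand the indicator of zero in characters; independence factors the average, φ being the
transform of one step. -/
lemma walkProb_eq_sum {Ω ι : Type*} [Fintype Ω] [Fintype ι] [DecidableEq ι] (f : Ω → ZMod p)
    (φ : ZMod p → ℝ)
    (hφ : ∀ s, (∑ ω, (ZMod.stdAddChar (s * f ω) : ℂ)) / Fintype.card Ω = φ s) (a : ι → ZMod p) :
    (p : ℝ) * walkProb f a = ∑ t, ∏ i, φ (t * a i) := by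
  have key : ((p * walkProb f a : ℝ) : ℂ) = ((∑ t, ∏ i, φ (t * a i) : ℝ) : ℂ) := by
    push_cast
    simp_rw [← hφ, Finset.prod_div_distrib, Finset.prod_univ_sum, Fintype.piFinset_univ]
    simp only [walkProb, avg, Complex.ofReal_div, Complex.ofReal_sum]
    rw [mul_div_assoc', Finset.mul_sum, ← Finset.sum_div, Finset.sum_comm]
    simp only [ind_eq_sum_stdAddChar]
    congr 1
    · refine Finset.sum_congr rfl fun x _ => Finset.sum_congr rfl fun t _ => ?_
      rw [← stdAddChar_sum, Finset.mul_sum]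
      refine congrArg _ (Finset.sum_congr rfl fun i _ => by ring)
    · simp
  exact_mod_cast key

lemma signProb_eq_sum {ι : Type*} [Fintype ι] [DecidableEq ι] (a : ι → ZMod p) :
    (p : ℝ) * signProb a = ∑ t, ∏ i, zcos (t * a i) := by
  refine walkProb_eq_sum _ _ (fun s => ?_) a
  rw [show (Finset.univ : Finset ℤˣ) = {1, -1} from rfl]
  simp only [Finset.sum_insert (show (1 : ℤˣ) ∉ ({-1} : Finset ℤˣ) by decide),
    Finset.sum_singleton]
  simp only [Units.val_one, Int.cast_one, mul_one, Units.val_neg, Int.cast_neg, mul_neg,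
    stdAddChar_neg, Complex.add_conj, zcos]
  simp

/-- The lazy step: `2` and `-2` with probability `1/8` each, `0` otherwise. -/
def lazyStep (R : Type*) [CommRing R] : Fin 8 → R := ![2, -2, 0, 0, 0, 0, 0, 0]

/-- Rests on (1 + cos² θ)/2 = 3/4 + (cos 2θ)/4. -/
lemma lazyProb_eq_sum {ι : Type*} [Fintype ι] [DecidableEq ι] (a : ι → ZMod p) :
    (p : ℝ) * walkProb (lazyStep (ZMod p)) a = ∑ t, ∏ i, lazyCos (t * a i) := by
  refine walkProb_eq_sum _ _ (fun s => ?_) a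
  have h1 : (ZMod.stdAddChar (s * 2) : ℂ) = ZMod.stdAddChar s ^ 2 := by
    rw [mul_two, AddChar.map_add_eq_mul, sq]
  have h2 : ((ZMod.stdAddChar s : ℂ).re) ^ 2 + ((ZMod.stdAddChar s : ℂ).im) ^ 2 = 1 := by
    have := Complex.sq_norm (ZMod.stdAddChar s : ℂ)
    rw [norm_stdAddChar, Complex.normSq_apply] at this
    nlinarith
  simp only [lazyStep, Fin.sum_univ_eight]
  simp only [Matrix.cons_val, mul_neg, mul_zero, stdAddChar_neg, h1, AddChar.map_zero_eq_one,
    lazyCos, zcos, Fintype.card_fin]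
  apply Complex.ext
  · simp [sq]
    nlinarith
  · simp [sq]
    ring

lemma signProb_le_sum_lazyCos {ι : Type*} [Fintype ι] [DecidableEq ι] (a : ι → ZMod p) :
    (p : ℝ) * signProb a ≤ ∑ t, ∏ i, lazyCos (t * a i) := by
  rw [signProb_eq_sum]
  refine Finset.sum_le_sum fun t _ => (le_abs_self _).trans ?_
  rw [Finset.abs_prod]
  exact Finset.prod_le_prod (fun _ _ => abs_nonneg _) fun _ _ => abs_zcos_le_lazyCos _

lemma signProb_le_lazyProb {ι : Type*} [Fintype ι] [DecidableEq ι] (a : ι → ZMod p) :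
    signProb a ≤ walkProb (lazyStep (ZMod p)) a := by
  have hp : (0 : ℝ) < p := by exact_mod_cast (Fact.out : p.Prime).pos
  have := signProb_le_sum_lazyCos a
  rw [← lazyProb_eq_sum] at this
  exact le_of_mul_le_mul_left this hp

lemma two_ne_zero_of_ne_two (hp : p ≠ 2) : (2 : ZMod p) ≠ 0 := by
  intro h
  have := (ZMod.natCast_eq_zero_iff 2 p).1 (by exact_mod_cast h)
  exact hp ((Nat.prime_dvd_prime_iff_eq Fact.out Nat.prime_two).1 this)

lemma avg_lazyStep_le (hp : p ≠ 2) (v : ZMod p) :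
    avg (fun ω => ind (lazyStep (ZMod p) ω = v)) ≤ 3 / 4 := by
  have h2 := two_ne_zero_of_ne_two hp
  simp only [avg, lazyStep, Fin.sum_univ_eight]
  simp only [Matrix.cons_val, Fintype.card_fin]
  by_cases hv : v = 0
  · subst hv
    rw [ind_of_false h2, ind_of_false (neg_ne_zero.2 h2), ind_of_true rfl]
    norm_num
  · rw [ind_of_false (Ne.symm hv)]
    have := ind_le_one ((2 : ZMod p) = v)
    have := ind_le_one ((-2 : ZMod p) = v)
    norm_num
    linarith

end Fourier

/-! ### Halász-type concentration bounds -/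

section Halasz
variable {p : ℕ} [Fact p.Prime] {ι : Type*} [Fintype ι]

/-- The sine on `ZMod p`. -/
noncomputable def zsin (s : ZMod p) : ℝ := (ZMod.stdAddChar s : ℂ).im

lemma zcos_sq_add_zsin_sq (s : ZMod p) : zcos s ^ 2 + zsin s ^ 2 = 1 := by
  have := Complex.sq_norm (ZMod.stdAddChar s : ℂ)
  rw [norm_stdAddChar, Complex.normSq_apply] at this
  unfold zcos zsin
  nlinarith

lemma zsin_add (s t : ZMod p) : zsin (s + t) = zcos s * zsin t + zsin s * zcos t := by
  simp [zsin, zcos, AddChar.map_add_eq_mul, Complex.mul_im]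

lemma zcos_two_mul (s : ZMod p) : zcos (2 * s) = 1 - 2 * zsin s ^ 2 := by
  have := zcos_sq_add_zsin_sq s
  have h : zcos (2 * s) = zcos s * zcos s - zsin s * zsin s := by
    simp [zsin, zcos, two_mul, AddChar.map_add_eq_mul, Complex.mul_re]
  rw [h]
  nlinarith

lemma zsin_zero : zsin (0 : ZMod p) = 0 := by simp [zsin]

lemma abs_zsin_add_le (s t : ZMod p) : |zsin (s + t)| ≤ |zsin s| + |zsin t| := by
  rw [zsin_add]
  refine (abs_add_le _ _).trans ?_
  rw [abs_mul, abs_mul, add_comm]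
  gcongr
  · exact mul_le_of_le_one_right (abs_nonneg _) (abs_zcos_le_one _)
  · exact mul_le_of_le_one_left (abs_nonneg _) (abs_zcos_le_one _)

/-- The Euclidean length of the vector of sines of `x * t j`. -/
noncomputable def sinNorm (t : ι → ZMod p) (x : ZMod p) : ℝ :=
  √(∑ j, zsin (x * t j) ^ 2)

lemma sinNorm_nonneg (t : ι → ZMod p) (x : ZMod p) : 0 ≤ sinNorm t x := Real.sqrt_nonneg _

lemma sinNorm_sq (t : ι → ZMod p) (x : ZMod p) :
    sinNorm t x ^ 2 = ∑ j, zsin (x * t j) ^ 2 :=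
  Real.sq_sqrt (Finset.sum_nonneg fun _ _ => sq_nonneg _)

/-- Coordinatewise subadditivity of |sin| and the Euclidean triangle inequality. Hence sums of balls
lie in balls of the summed radius. -/
lemma sinNorm_add_le (t : ι → ZMod p) (x y : ZMod p) :
    sinNorm t (x + y) ≤ sinNorm t x + sinNorm t y := by
  let u : ZMod p → EuclideanSpace ℝ ι := fun x => WithLp.toLp 2 fun j => |zsin (x * t j)|
  have hu : ∀ x, sinNorm t x = ‖u x‖ := fun x => by
    simp [sinNorm, EuclideanSpace.norm_eq, u]
  rw [hu x, hu y]
  refine le_trans ?_ (norm_add_le _ _)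
  rw [EuclideanSpace.norm_eq]
  refine Real.sqrt_le_sqrt (Finset.sum_le_sum fun j _ => ?_)
  simp only [u, PiLp.add_apply, Real.norm_eq_abs, sq_abs]
  rw [← sq_abs, add_mul]
  exact pow_le_pow_left₀ (abs_nonneg _) (abs_zsin_add_le _ _) 2

open Classical in
/-- The ball of radius `r` for `sinNorm`. -/
noncomputable def sinBall (t : ι → ZMod p) (r : ℝ) : Finset (ZMod p) :=
  Finset.univ.filter fun x => sinNorm t x ≤ r

lemma mem_sinBall {t : ι → ZMod p} {r : ℝ} {x : ZMod p} : x ∈ sinBall t r ↔ sinNorm t x ≤ r := by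
  simp [sinBall]

lemma zero_mem_sinBall (t : ι → ZMod p) {r : ℝ} (hr : 0 ≤ r) : 0 ∈ sinBall t r := by
  simp [mem_sinBall, sinNorm, zsin_zero, hr]

/-- Iterated Cauchy–Davenport for m-fold sums of the small ball. -/
lemma min_le_card_sinBall (t : ι → ZMod p) {r : ℝ} (hr : 0 ≤ r) (m : ℕ) :
    min p (m * ((sinBall t r).card - 1) + 1) ≤ (sinBall t (m * r)).card := by
  induction m with
  | zero =>
    refine (min_le_right _ _).trans ?_
    simpa using Finset.card_pos.2 ⟨0, zero_mem_sinBall t le_rfl⟩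
  | succ m ih =>
    open scoped Pointwise in
    have hsub : sinBall t (m * r) + sinBall t r ⊆ sinBall t ((m + 1 : ℕ) * r) := by
      intro x hx
      obtain ⟨y, hy, z, hz, rfl⟩ := Finset.mem_add.1 hx
      rw [mem_sinBall] at *
      refine (sinNorm_add_le t y z).trans ?_
      push_cast
      linarith
    have hm : 0 ≤ m * r := by positivity
    have h1 : (sinBall t r).Nonempty := ⟨0, zero_mem_sinBall t hr⟩
    have h2 := ZMod.cauchy_davenport (Fact.out : p.Prime) ⟨0, zero_mem_sinBall t hm⟩ h1
    have h3 := h2.trans (Finset.card_le_card hsub)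
    have h4 := h1.card_pos
    refine le_trans ?_ h3
    rw [add_mul]
    omega

lemma card_sinBall_le (t : ι → ZMod p) {r : ℝ} (hr : 0 ≤ r) {m : ℕ} (hm : 0 < m)
    (h : (sinBall t (m * r)).card < p) :
    ((sinBall t r).card : ℝ) ≤ 1 + (sinBall t (m * r)).card / m := by
  have h1 := min_le_card_sinBall t hr m
  have h2 : m * ((sinBall t r).card - 1) + 1 ≤ (sinBall t (m * r)).card := by
    rcases min_le_iff.1 h1 with h1 | h1
    · omega
    · exact h1
  have h3 : 1 ≤ (sinBall t r).card := Finset.card_pos.2 ⟨0, zero_mem_sinBall t hr⟩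
  have hm' : (0 : ℝ) < m := by exact_mod_cast hm
  rw [← sub_le_iff_le_add', le_div_iff₀ hm', mul_comm]
  have h4 : m * ((sinBall t r).card - 1) ≤ (sinBall t (m * r)).card := by omega
  calc (m : ℝ) * ((sinBall t r).card - 1) = ((m * ((sinBall t r).card - 1) : ℕ) : ℝ) := by
        rw [Nat.cast_mul, Nat.cast_sub h3, Nat.cast_one]
    _ ≤ _ := by exact_mod_cast h4

/-- `lazyCos` equals 1 - sin²/2, and 1 - u ≤ exp(-u). -/
lemma prod_lazyCos_le (t : ι → ZMod p) (x : ZMod p) :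
    ∏ j, lazyCos (x * t j) ≤ Real.exp (-(sinNorm t x ^ 2 / 2)) := by
  rw [sinNorm_sq, Finset.sum_div, ← Finset.sum_neg_distrib, Real.exp_sum]
  refine Finset.prod_le_prod (fun _ _ => lazyCos_nonneg _) fun j _ => ?_
  have h1 := zcos_sq_add_zsin_sq (x * t j)
  have h2 := Real.add_one_le_exp (-(zsin (x * t j) ^ 2 / 2))
  unfold lazyCos
  linarith

/-- Halász's inequality, in terms of the size of a ball. -/
lemma lazyProb_le_of_card_sinBall_le [DecidableEq ι] (t : ι → ZMod p) {r R : ℝ} (hr : 0 ≤ r)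
    {m : ℕ} (hm : 0 < m) (hR : (sinBall t (m * r)).card ≤ R) (hRp : R < p) :
    walkProb (lazyStep (ZMod p)) t ≤ Real.exp (-(r ^ 2 / 2)) + 1 / p + R / (p * m) := by
  have hp : (0 : ℝ) < p := by exact_mod_cast (Fact.out : p.Prime).pos
  have hm' : (0 : ℝ) < m := by exact_mod_cast hm
  have hcard := card_sinBall_le t hr hm (by exact_mod_cast hR.trans_lt hRp)
  have h1 : (p : ℝ) * walkProb (lazyStep (ZMod p)) t ≤
      p * Real.exp (-(r ^ 2 / 2)) + (sinBall t r).card := by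
    classical
    rw [lazyProb_eq_sum]
    -- Each product is at most 1 inside the ball and exponentially small outside.
    calc ∑ x, ∏ j, lazyCos (x * t j)
        ≤ ∑ x : ZMod p, (Real.exp (-(r ^ 2 / 2)) + if x ∈ sinBall t r then 1 else 0) := by
          refine Finset.sum_le_sum fun x _ => ?_
          split_ifs with h
          · refine le_add_of_nonneg_of_le (Real.exp_nonneg _) ?_
            exact Finset.prod_le_one (fun _ _ => lazyCos_nonneg _) fun _ _ => lazyCos_le_one _
          · rw [mem_sinBall, not_le] at h
            rw [add_zero]
            refine (prod_lazyCos_le t x).trans (Real.exp_le_exp.2 ?_)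
            have := pow_le_pow_left₀ hr h.le 2
            linarith
      _ = _ := by simp [Finset.sum_add_distrib, ZMod.card]
  have h2 : walkProb (lazyStep (ZMod p)) t ≤
      (p * Real.exp (-(r ^ 2 / 2)) + (1 + R / m)) / p := by
    rw [le_div_iff₀ hp, mul_comm]
    refine h1.trans ?_
    gcongr
    exact hcard.trans (by gcongr)
  refine h2.trans_eq ?_
  field_simp
  ring

/-- Parseval for the indicator of S. -/
lemma sum_normSq_sum_stdAddChar (S : Finset (ZMod p)) :
    ∑ s : ZMod p, ‖∑ x ∈ S, (ZMod.stdAddChar (s * x) : ℂ)‖ ^ 2 = p * S.card := by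
  have key : ((∑ s : ZMod p, ‖∑ x ∈ S, (ZMod.stdAddChar (s * x) : ℂ)‖ ^ 2 : ℝ) : ℂ) =
      ((p * S.card : ℝ) : ℂ) := by
    push_cast
    calc ∑ s : ZMod p, ((‖∑ x ∈ S, (ZMod.stdAddChar (s * x) : ℂ)‖ : ℝ) : ℂ) ^ 2
        = ∑ s : ZMod p, ∑ x ∈ S, ∑ y ∈ S, (ZMod.stdAddChar (s * (x - y)) : ℂ) := by
          refine Finset.sum_congr rfl fun s _ => ?_
          rw [← Complex.mul_conj', map_sum, Finset.sum_mul_sum]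
          refine Finset.sum_congr rfl fun x _ => Finset.sum_congr rfl fun y _ => ?_
          rw [← stdAddChar_neg, ← AddChar.map_add_eq_mul]
          congr 1
          ring
      _ = ∑ x ∈ S, ∑ y ∈ S, (p : ℂ) * (ind (x - y = 0) : ℝ) := by
          rw [Finset.sum_comm]
          refine Finset.sum_congr rfl fun x _ => ?_
          rw [Finset.sum_comm]
          exact Finset.sum_congr rfl fun y _ => (ind_eq_sum_stdAddChar _).symm
      _ = ∑ x ∈ S, (p : ℂ) := by
          refine Finset.sum_congr rfl fun x hx => ?_
          rw [Finset.sum_eq_single x]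
          · simp [ind]
          · intro y _ hy
            rw [ind_of_false (sub_ne_zero.2 (Ne.symm hy))]
            simp
          · exact fun h => absurd hx h
      _ = p * S.card := by simp [mul_comm]
  exact_mod_cast key

lemma re_sum_stdAddChar_le (S : Finset (ZMod p)) (s : ZMod p) :
    ∑ x ∈ S, zcos (s * x) ≤ ‖∑ x ∈ S, (ZMod.stdAddChar (s * x) : ℂ)‖ := by
  refine le_trans (le_of_eq ?_) (Complex.re_le_norm _)
  simp [zcos]

/-- By cos 2θ = 1 - 2 sin² θ, a small sine norm on S forces S to correlate with the frequencies 2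
t_j. -/
lemma sum_zcos_ge (t : ι → ZMod p) {A : ℝ} (T : Finset ι) {S : Finset (ZMod p)}
    (hS : ∀ x ∈ S, sinNorm t x ^ 2 ≤ A) :
    (T.card - 2 * A) * S.card ≤ ∑ j ∈ T, ∑ x ∈ S, zcos (2 * t j * x) := by
  rw [Finset.sum_comm, mul_comm, ← nsmul_eq_mul]
  refine Finset.card_nsmul_le_sum _ _ _ fun x hx => ?_
  have h1 := hS x hx
  rw [sinNorm_sq] at h1
  have h2 : ∑ j ∈ T, zsin (x * t j) ^ 2 ≤ ∑ j, zsin (x * t j) ^ 2 :=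
    Finset.sum_le_univ_sum_of_nonneg fun _ => sq_nonneg _
  have h3 : ∑ j ∈ T, zcos (2 * t j * x) = T.card - 2 * ∑ j ∈ T, zsin (x * t j) ^ 2 := by
    rw [Finset.mul_sum, Finset.card_eq_sum_ones, Nat.cast_sum, ← Finset.sum_sub_distrib]
    refine Finset.sum_congr rfl fun j _ => ?_
    rw [mul_assoc, zcos_two_mul, mul_comm x]
    simp
  rw [h3]
  linarith

/-- The distinct frequencies 2 t_j carry Fourier coefficients of S of average size at least |S|/2,
while all squares sum to p|S|; Cauchy–Schwarz compares the two. -/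
lemma card_mul_le_of_injective (hp : p ≠ 2) {t : ι → ZMod p} (ht : Function.Injective t)
    {S : Finset (ZMod p)} (hS : ∀ x ∈ S, sinNorm t x ^ 2 ≤ (Fintype.card ι : ℝ) / 4) :
    (S.card : ℝ) * Fintype.card ι ≤ 4 * p := by
  set K : ℝ := (Fintype.card ι : ℝ)
  have hK : 0 ≤ K := Nat.cast_nonneg _
  have h2 := two_ne_zero_of_ne_two hp
  have h1 := sum_zcos_ge t Finset.univ hS
  rw [Finset.card_univ] at h1
  set h : ZMod p → ℝ := fun s => ‖∑ x ∈ S, (ZMod.stdAddChar (s * x) : ℂ)‖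
  have h3 : K / 2 * S.card ≤ ∑ j, h (2 * t j) := by
    calc K / 2 * S.card = (K - 2 * (K / 4)) * S.card := by ring
      _ ≤ _ := h1
      _ ≤ _ := Finset.sum_le_sum fun j _ => re_sum_stdAddChar_le S _
  have h4 : ∑ j, h (2 * t j) ^ 2 ≤ p * S.card := by
    rw [← sum_normSq_sum_stdAddChar]
    have hinj : Function.Injective fun j => 2 * t j := fun i j hij => ht (mul_left_cancel₀ h2 hij)
    rw [← Finset.sum_image (s := Finset.univ) (g := fun j => 2 * t j) (f := fun s => h s ^ 2)
      (fun i _ j _ hij => hinj hij)]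
    exact Finset.sum_le_univ_sum_of_nonneg fun _ => sq_nonneg _
  have h5 : (∑ j, h (2 * t j)) ^ 2 ≤ K * ∑ j, h (2 * t j) ^ 2 := by
    simpa using sq_sum_le_card_mul_sum_sq (s := Finset.univ) (f := fun j => h (2 * t j))
  have h6 : (K / 2 * S.card) ^ 2 ≤ K * (p * S.card) :=
    (pow_le_pow_left₀ (by positivity) h3 2).trans (h5.trans (by gcongr))
  rcases eq_or_lt_of_le (by positivity : 0 ≤ K * S.card) with h0 | h0
  · rw [mul_comm, ← h0]; positivity
  · nlinarith

/-- At a nonzero frequency the cosines sum to zero over `ZMod p`, so the part over S is at most p -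
|S|; on average it is at least |S|/2. -/
lemma card_le_of_ne_zero (hp : p ≠ 2) {t : ι → ZMod p} {T : Finset ι} (hT0 : T.Nonempty)
    (hT : ∀ j ∈ T, t j ≠ 0)
    {S : Finset (ZMod p)} (hS : ∀ x ∈ S, sinNorm t x ^ 2 ≤ (T.card : ℝ) / 4) :
    (S.card : ℝ) ≤ 2 / 3 * p := by
  have h2 := two_ne_zero_of_ne_two hp
  have h1 := sum_zcos_ge t T hS
  have h3 : ∀ j ∈ T, ∑ x ∈ S, zcos (2 * t j * x) ≤ p - S.card := by
    intro j hj
    have hs : 2 * t j ≠ 0 := mul_ne_zero h2 (hT j hj)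
    have h4 : ∑ x : ZMod p, zcos (2 * t j * x) = 0 := by
      have := congrArg Complex.re (ind_eq_sum_stdAddChar (2 * t j))
      rw [ind_of_false hs] at this
      simp only [Complex.ofReal_zero, mul_zero, Complex.zero_re, Complex.re_sum] at this
      rw [this]
      exact Finset.sum_congr rfl fun x _ => by rw [zcos, mul_comm]
    classical
    rw [← Finset.sum_add_sum_compl S] at h4
    have h5 : -∑ x ∈ Sᶜ, zcos (2 * t j * x) ≤ Sᶜ.card := by
      rw [← Finset.sum_neg_distrib, Finset.card_eq_sum_ones, Nat.cast_sum]
      refine Finset.sum_le_sum fun x _ => ?_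
      simpa using (neg_le_abs _).trans (abs_zcos_le_one (2 * t j * x))
    rw [Finset.card_compl, Nat.cast_sub (Finset.card_le_univ _), ZMod.card] at h5
    linarith
  have h6 := Finset.sum_le_card_nsmul _ _ _ h3
  rw [nsmul_eq_mul] at h6
  have h7 : (0 : ℝ) < T.card := by exact_mod_cast hT0.card_pos
  nlinarith

lemma sinBall_sq {t : ι → ZMod p} {r A : ℝ} {m : ℕ} (h : m * r = √A) (hA : 0 ≤ A) :
    ∀ x ∈ sinBall t (m * r), sinNorm t x ^ 2 ≤ A := fun x hx => by
  rw [mem_sinBall, h] at hx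
  have := pow_le_pow_left₀ (sinNorm_nonneg t x) hx 2
  rwa [Real.sq_sqrt hA] at this

/-- The concentration of a lazy walk with distinct steps. -/
lemma lazyProb_le_of_injective [DecidableEq ι] (hp : p ≠ 2) {t : ι → ZMod p}
    (ht : Function.Injective t) (hι : 4 < Fintype.card ι) {m : ℕ} (hm : 0 < m) :
    walkProb (lazyStep (ZMod p)) t ≤
      Real.exp (-(Fintype.card ι / (8 * m ^ 2))) + 1 / p + 4 / (Fintype.card ι * m) := by
  have hK : (4 : ℝ) < Fintype.card ι := by exact_mod_cast hι
  set K : ℝ := (Fintype.card ι : ℝ)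
  have hm' : (0 : ℝ) < m := by exact_mod_cast hm
  have hp0 : (0 : ℝ) < p := by exact_mod_cast (Fact.out : p.Prime).pos
  have hmr : m * (√(K / 4) / m) = √(K / 4) := by field_simp
  have hcard := card_mul_le_of_injective hp ht (sinBall_sq (t := t) hmr (by positivity))
  -- The radius is chosen so that the m-fold ball has squared radius K/4, where the counting bound
  -- applies; K > 4 keeps that ball from being everything.
  have := lazyProb_le_of_card_sinBall_le t (r := √(K / 4) / m) (R := 4 * p / K) (by positivity) hm
    (by rwa [le_div_iff₀ (by positivity)])
    (by rw [div_lt_iff₀ (by positivity)]; nlinarith)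
  refine this.trans_eq ?_
  rw [div_pow, Real.sq_sqrt (by positivity)]
  have e1 : K / 4 / m ^ 2 / 2 = K / (8 * m ^ 2) := by
    field_simp
    norm_num
  have e2 : 4 * p / K / (p * m) = 4 / (K * m) := by
    field_simp
  rw [e1, e2]

/-- The concentration of a lazy walk with many nonzero steps. -/
lemma lazyProb_le_of_ne_zero [DecidableEq ι] (hp : p ≠ 2) {t : ι → ZMod p}
    {T : Finset ι} (hT0 : T.Nonempty) (hT : ∀ j ∈ T, t j ≠ 0) {m : ℕ} (hm : 0 < m) :
    walkProb (lazyStep (ZMod p)) t ≤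
      Real.exp (-(T.card / (8 * m ^ 2))) + 1 / p + 1 / m := by
  have hK : (0 : ℝ) < T.card := by exact_mod_cast hT0.card_pos
  have hm' : (0 : ℝ) < m := by exact_mod_cast hm
  have hp0 : (0 : ℝ) < p := by exact_mod_cast (Fact.out : p.Prime).pos
  have hmr : m * (√(T.card / 4) / m) = √(T.card / 4) := by field_simp
  have hcard := card_le_of_ne_zero hp hT0 hT (sinBall_sq (t := t) hmr (by positivity))
  have := lazyProb_le_of_card_sinBall_le t (r := √(T.card / 4) / m) (R := 2 / 3 * p)
    (by positivity) hm hcard (by linarith)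
  refine this.trans ?_
  rw [div_pow, Real.sq_sqrt (by positivity)]
  have e1 : (T.card : ℝ) / 4 / m ^ 2 / 2 = T.card / (8 * m ^ 2) := by
    field_simp
    norm_num
  have e2 : 2 / 3 * (p : ℝ) / (p * m) ≤ 1 / m := by
    rw [div_le_div_iff₀ (by positivity) (by positivity)]
    nlinarith [mul_pos hp0 hm']
  rw [e1]
  linarith

end Halasz

/-! ### Odlyzko's bound and expected numbers of orthogonal vectors -/

section Odlyzko

lemma avg_avg_update {Ω κ : Type*} [Fintype Ω] [Fintype κ] [DecidableEq κ] (j : κ)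
    (F : (κ → Ω) → ℝ) :
    avg (fun y => avg fun ω => F (Function.update y j ω)) = avg F := by
  have hupd : ∀ ω ω' z, Function.update ((Equiv.funSplitAt j Ω).symm (ω', z)) j ω =
      (Equiv.funSplitAt j Ω).symm (ω, z) := by
    intro ω ω' z
    ext i
    by_cases hi : i = j
    · subst hi; simp [Equiv.funSplitAt, Equiv.piSplitAt]
    · simp [Equiv.funSplitAt, Equiv.piSplitAt, hi]
  rw [← avg_equiv (Equiv.funSplitAt j Ω).symm F,
    ← avg_equiv (Equiv.funSplitAt j Ω).symm (fun y => avg fun ω => F (Function.update y j ω)),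
    avg_prod, avg_prod]
  simp only [hupd]
  rcases isEmpty_or_nonempty Ω with h | h
  · simp [avg]
  · rw [avg_const, avg_comm]

/-- Condition on all coordinates but j: then A and h are fixed and coordinate j must hit one value.
-/
lemma avg_ind_and_eq_le {F Ω κ : Type*} [Fintype Ω] [Fintype κ] [DecidableEq κ] (f : Ω → F) {α : ℝ} (hα : ∀ v, avg (fun ω => ind (f ω = v)) ≤ α) (j : κ)
    (A : (κ → Ω) → Prop) (hA : ∀ y ω, A (Function.update y j ω) ↔ A y)
    (h : (κ → Ω) → F) (hh : ∀ y ω, h (Function.update y j ω) = h y) :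
    avg (fun y => ind (A y ∧ f (y j) = h y)) ≤ α * avg (fun y => ind (A y)) := by
  rw [← avg_avg_update j, ← avg_mul_left]
  refine avg_mono fun y => ?_
  simp only [ind_and, hh, Function.update_self, ind_congr (hA y _)]
  rw [avg_mul_left, mul_comm]
  exact mul_le_mul_of_nonneg_right (hα _) (ind_nonneg _)

lemma finrank_inf_ker_add_one {F V : Type*} [Field F] [AddCommGroup V] [Module F V] [FiniteDimensional F V]
    (U : Submodule F V) (φ : V →ₗ[F] F) {t : V} (ht : t ∈ U) (hφ : φ t ≠ 0) :
    Module.finrank F (U ⊓ LinearMap.ker φ : Submodule F V) + 1 = Module.finrank F U := by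
  have h1 := (φ.domRestrict U).finrank_range_add_finrank_ker
  have h2 : LinearMap.range (φ.domRestrict U) = ⊤ := by
    apply LinearMap.range_eq_top.2
    apply LinearMap.surjective
    intro h
    exact hφ (by simpa using LinearMap.congr_fun h ⟨t, ht⟩)
  rw [h2, finrank_top, Module.finrank_self] at h1
  have h3 : LinearMap.ker (φ.domRestrict U) = Submodule.comap U.subtype (LinearMap.ker φ) := by
    ext x; simp
  rw [← h1, ← Submodule.map_comap_subtype, Submodule.finrank_map_subtype_eq, h3, add_comm]

/-- The linear form `t ↦ ∑ j, v j * t j`. -/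
def dotForm {F κ : Type*} [Field F] [Fintype κ] (v : κ → F) : (κ → F) →ₗ[F] F :=
  ∑ j, v j • LinearMap.proj j

lemma dotForm_apply {F κ : Type*} [Field F] [Fintype κ] (v t : κ → F) :
    dotForm v t = ∑ j, v j * t j := by
  simp [dotForm]

variable {F Ω κ : Type*} [Field F] [Fintype Ω] [Nonempty Ω] [Fintype κ] [DecidableEq κ]

/-- Odlyzko's bound. -/
lemma avg_orthogonal_le (f : Ω → F) {α : ℝ} (hα : ∀ v, avg (fun ω => ind (f ω = v)) ≤ α)
    (d : ℕ) (U : Submodule F (κ → F)) (hd : d ≤ Module.finrank F U) :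
    avg (fun y : κ → Ω => ind (∀ t ∈ U, ∑ j, f (y j) * t j = 0)) ≤ α ^ d := by
  have hα0 : 0 ≤ α := (avg_nonneg fun _ => ind_nonneg _).trans (hα 0)
  induction d generalizing U with
  | zero => simpa using avg_le_of_le fun y : κ → Ω => ind_le_one _
  | succ d ih =>
    -- The vectors of U vanishing at j lose one dimension and impose conditions blind to coordinate
    -- j; the condition from t then determines `f (y j)`.
    obtain ⟨t, htU, ht0⟩ := U.ne_bot_iff.1 (fun h => by rw [h, finrank_bot] at hd; omega)
    obtain ⟨j, hj⟩ := Function.ne_iff.1 ht0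
    have hrank := finrank_inf_ker_add_one U (LinearMap.proj j) htU hj
    rw [pow_succ']
    refine le_trans ?_ (mul_le_mul_of_nonneg_left
      (ih (U ⊓ LinearMap.ker (LinearMap.proj j)) (by omega)) hα0)
    refine le_trans (avg_mono fun y => ind_mono ?_) (avg_ind_and_eq_le f hα j
      (fun y => ∀ s ∈ U ⊓ LinearMap.ker (LinearMap.proj j), ∑ i, f (y i) * s i = 0) ?_
      (fun y => -(∑ i ∈ Finset.univ.erase j, f (y i) * t i) / t j) ?_)
    · intro h
      refine ⟨fun s hs => h s hs.1, ?_⟩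
      have h1 := h t htU
      rw [← Finset.add_sum_erase _ _ (Finset.mem_univ j)] at h1
      rw [eq_div_iff hj, eq_neg_iff_add_eq_zero, h1]
    · intro y ω
      refine forall₂_congr fun s hs => ?_
      have hsj : s j = 0 := by simpa using hs.2
      rw [Finset.sum_congr rfl fun i _ => ?_]
      by_cases hi : i = j
      · subst hi; simp [hsj]
      · rw [Function.update_of_ne hi]
    · intro y ω
      congr 2
      refine Finset.sum_congr rfl fun i hi => ?_
      rw [Function.update_of_ne (Finset.ne_of_mem_erase hi)]

-- The sum is the expected number of t in D ∩ U orthogonal to n independent random rows. Write d for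
-- the dimension of U. A revealed row either lowers it by one or, with probability at most min(α^d,
-- β), is orthogonal to all of U; having two alternatives per row gives 2^n. Hypothesis `h` prices a
-- history ending in dimension i: at most |F|^i vectors remain, and at least n - (d - i) rows failed
-- to cut.
open Classical in
lemma sum_walkProb_pow_le_of_submodule [Fintype F] (f : Ω → F) {α β : ℝ}
    (hα : ∀ v, avg (fun ω => ind (f ω = v)) ≤ α) (hα1 : α ≤ 1) (hβ0 : 0 ≤ β)
    (D : Finset (κ → F)) (h0 : 0 ∉ D)
    (hβ : ∀ t ∈ D, walkProb f t ≤ β) (n : ℕ) (B : ℝ) (hB : 0 ≤ B) (U : Submodule F (κ → F))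
    (h : ∀ i, 1 ≤ i → i ≤ Module.finrank F U →
      (Fintype.card F : ℝ) ^ i * min (α ^ i) β ^ (n - (Module.finrank F U - i)) ≤ B) :
    ∑ t ∈ D.filter (· ∈ U), walkProb f t ^ n ≤ 2 ^ n * B := by
  have hα0 : 0 ≤ α := (avg_nonneg fun _ => ind_nonneg _).trans (hα 0)
  have hγ0 : ∀ i, 0 ≤ min (α ^ i) β := fun i => le_min (by positivity) hβ0
  have hγ1 : ∀ i, min (α ^ i) β ≤ 1 := fun i => (min_le_left _ _).trans (pow_le_one₀ hα0 hα1)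
  induction n generalizing B U with
  | zero =>
    simp only [pow_zero, Finset.sum_const, nsmul_eq_mul, mul_one, one_mul, zero_tsub] at h ⊢
    rcases Nat.eq_zero_or_pos (Module.finrank F U) with hU | hU
    · rw [Submodule.finrank_eq_zero] at hU
      rw [Finset.card_eq_zero.2]
      · simpa using hB
      · refine Finset.filter_eq_empty_iff.2 fun t ht htU => h0 ?_
        rw [hU, Submodule.mem_bot] at htU
        rwa [← htU]
    · refine le_trans ?_ (h _ hU le_rfl)
      rw [← Nat.cast_pow, ← Module.card_eq_pow_finrank (K := F) (V := U), Nat.cast_le,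
        Fintype.card_subtype]
      exact Finset.card_le_card (Finset.filter_subset_filter _ (Finset.subset_univ _))
  | succ n ih =>
    set d := Module.finrank F U with hd
    set S := ∑ t ∈ D.filter (· ∈ U), walkProb f t ^ n with hS
    have hS0 : 0 ≤ S := Finset.sum_nonneg fun t _ => pow_nonneg (walkProb_nonneg f t) n
    have h2B : (0 : ℝ) ≤ 2 ^ n * B := by positivity
    rcases (D.filter (· ∈ U)).eq_empty_or_nonempty with hE | ⟨t₀, ht₀⟩
    · rw [hE, Finset.sum_empty]; positivity
    rw [Finset.mem_filter] at ht₀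
    have hd1 : 1 ≤ d := by
      rw [Nat.one_le_iff_ne_zero, hd, Ne, Submodule.finrank_eq_zero]
      intro hU
      have := ht₀.2
      rw [hU, Submodule.mem_bot] at this
      exact h0 (this ▸ ht₀.1)
    have hstep : ∀ y : κ → Ω,
        ∑ t ∈ D.filter (· ∈ U), ind (∑ j, f (y j) * t j = 0) * walkProb f t ^ n ≤
          ind (∀ t ∈ U, ∑ j, f (y j) * t j = 0) * S + 2 ^ n * B := by
      intro y
      by_cases hy : ∀ t ∈ U, ∑ j, f (y j) * t j = 0
      · rw [ind_of_true hy, one_mul]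
        refine le_add_of_le_of_nonneg (Finset.sum_le_sum fun t _ => ?_) h2B
        exact mul_le_of_le_one_left (pow_nonneg (walkProb_nonneg f t) n) (ind_le_one _)
      · rw [ind_of_false hy, zero_mul, zero_add]
        push Not at hy
        obtain ⟨t, htU, ht⟩ := hy
        have hrank := finrank_inf_ker_add_one U (dotForm fun j => f (y j)) htU
          (by rwa [dotForm_apply])
        refine le_trans (le_of_eq ?_)
          (ih B hB (U ⊓ LinearMap.ker (dotForm fun j => f (y j))) ?_)
        · rw [← Finset.sum_filter_add_sum_filter_not (D.filter (· ∈ U))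
            (fun t => ∑ j, f (y j) * t j = 0), Finset.filter_filter]
          rw [Finset.sum_eq_zero (s := Finset.filter
            (fun t => ¬ ∑ j, f (y j) * t j = 0) (D.filter (· ∈ U))), add_zero]
          · refine Finset.sum_congr ?_ ?_
            · ext s; simp [dotForm_apply]
            · intro s hs
              rw [Finset.mem_filter] at hs
              rw [ind_of_true (by simpa [dotForm_apply] using hs.2.2), one_mul]
          · intro s hs
            rw [ind_of_false (Finset.mem_filter.1 hs).2, zero_mul]
        · intro i hi hi'
          have := h i hi (by omega)
          rwa [show n + 1 - (d - i) = n - (Module.finrank F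
            (U ⊓ LinearMap.ker (dotForm fun j => f (y j)) : Submodule F (κ → F)) - i) by omega]
            at this
    -- The bound β comes from orthogonality to the single vector t₀ of D.
    have hP : avg (fun y : κ → Ω => ind (∀ t ∈ U, ∑ j, f (y j) * t j = 0)) ≤ min (α ^ d) β := by
      refine le_min (avg_orthogonal_le f hα d U le_rfl) (le_trans ?_ (hβ t₀ ht₀.1))
      exact avg_mono fun y => ind_mono fun hy => hy t₀ ht₀.2
    have hγS : min (α ^ d) β * S ≤ 2 ^ n * B := by
      rcases (hγ0 d).eq_or_lt with hz | hz
      · rw [← hz, zero_mul]; exact h2B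
      -- A row that does not cut pays for itself: B is divided by its probability bound.
      · have := ih (B / min (α ^ d) β) (div_nonneg hB hz.le) U (fun i hi hi' => ?_)
        · rw [← mul_div_assoc, le_div_iff₀ hz] at this
          rwa [mul_comm]
        · rw [le_div_iff₀ hz, mul_assoc]
          refine le_trans ?_ (h i hi hi')
          gcongr
          rcases le_or_gt (d - i) n with hn | hn
          · rw [show n + 1 - (d - i) = n - (d - i) + 1 by omega, pow_succ]
            refine mul_le_mul_of_nonneg_left ?_ (pow_nonneg (hγ0 i) _)
            exact min_le_min_right _ (pow_le_pow_of_le_one hα0 hα1 hi')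
          -- Both truncated exponents vanish, so a factor at most 1 suffices.
          · rw [show n - (d - i) = 0 by omega, show n + 1 - (d - i) = 0 by omega]
            simpa using hγ1 d
    calc ∑ t ∈ D.filter (· ∈ U), walkProb f t ^ (n + 1)
        = avg fun y : κ → Ω => ∑ t ∈ D.filter (· ∈ U),
            ind (∑ j, f (y j) * t j = 0) * walkProb f t ^ n := by
          rw [avg_sum]
          refine Finset.sum_congr rfl fun t _ => ?_
          rw [avg_mul_right, pow_succ', walkProb]
      _ ≤ avg fun y : κ → Ω =>
            ind (∀ t ∈ U, ∑ j, f (y j) * t j = 0) * S + 2 ^ n * B := avg_mono hstep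
      _ ≤ min (α ^ d) β * S + 2 ^ n * B := by
          rw [avg_add, avg_const, avg_mul_right]
          gcongr
      _ ≤ 2 ^ n * B + 2 ^ n * B := by gcongr
      _ = 2 ^ (n + 1) * B := by ring

/-- The expected number of vectors of `D` orthogonal to all the rows of a random matrix. -/
lemma sum_walkProb_pow_le [Fintype F] (f : Ω → F) {α β : ℝ}
    (hα : ∀ v, avg (fun ω => ind (f ω = v)) ≤ α) (hα1 : α ≤ 1) (hβ0 : 0 ≤ β) (hβ1 : β ≤ 1)
    (D : Finset (κ → F)) (h0 : 0 ∉ D) (hβ : ∀ t ∈ D, walkProb f t ≤ β) {n m₁ m₂ : ℕ}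
    (hn : m₁ + m₂ + Fintype.card κ ≤ n) (hm₁ : Fintype.card F * α ^ m₁ ≤ 1) :
    ∑ t ∈ D, walkProb f t ^ n ≤ 2 ^ n * β ^ m₂ := by
  classical
  have hα0 : 0 ≤ α := (avg_nonneg fun _ => ind_nonneg _).trans (hα 0)
  have := sum_walkProb_pow_le_of_submodule f hα hα1 hβ0 D h0 hβ n (β ^ m₂) (by positivity) ⊤ ?_
  · simpa using this
  · intro i hi hi'
    rw [finrank_top, Module.finrank_fintype_fun_eq_card] at *
    have hγ0 : 0 ≤ min (α ^ i) β := le_min (by positivity) hβ0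
    have hγ1 : min (α ^ i) β ≤ 1 := (min_le_right _ _).trans hβ1
    calc (Fintype.card F : ℝ) ^ i * min (α ^ i) β ^ (n - (Fintype.card κ - i))
        ≤ (Fintype.card F : ℝ) ^ i * min (α ^ i) β ^ (m₁ + m₂) := by
          gcongr ?_ * ?_
          exact pow_le_pow_of_le_one hγ0 hγ1 (by omega)
      -- The m₁ factors α^i cancel |F|^i; the other m₂ give the gain.
      _ ≤ (Fintype.card F : ℝ) ^ i * ((α ^ i) ^ m₁ * β ^ m₂) := by
          rw [pow_add]
          gcongr
          · exact min_le_left _ _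
          · exact min_le_right _ _
      _ = (Fintype.card F * α ^ m₁) ^ i * β ^ m₂ := by
          rw [mul_pow, ← pow_mul, ← pow_mul, mul_comm i, mul_assoc]
      _ ≤ β ^ m₂ := mul_le_of_le_one_left (by positivity) (pow_le_one₀ (by positivity) hm₁)

end Odlyzko

/-! ### Moment bound and exchange of vectors with frequencies -/

section Moments

-- Choose the t_j one at a time: fewer than k earlier points are forbidden, each of weight at most
-- 1, leaving weight at least Q - k.
open Classical in
lemma pow_le_sum_injective {T : Type*} [Fintype T] {G : T → ℝ} (hG0 : ∀ t, 0 ≤ G t)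
    (hG1 : ∀ t, G t ≤ 1) {Q : ℝ} (hQ : Q ≤ ∑ t, G t) (k : ℕ) (hk : k ≤ Q) :
    (Q - k) ^ k ≤ ∑ t : Fin k → T, ind (Function.Injective t) * ∏ j, G (t j) := by
  suffices H : ∀ l ≤ k, (Q - k) ^ l ≤ ∑ t : Fin l → T, ind (Function.Injective t) * ∏ j, G (t j)
    from H k le_rfl
  intro l hl
  induction l with
  | zero => simp [ind_of_true (Function.injective_of_subsingleton _)]
  | succ l ih =>
    have h1 : ∀ t : Fin l → T, Q - k ≤ ∑ x, ind (x ∉ Set.range t) * G x := by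
      intro t
      have h2 : ∑ x, G x ≤ ∑ x, (ind (x ∉ Set.range t) * G x + ind (x ∈ Set.range t)) := by
        refine Finset.sum_le_sum fun x _ => ?_
        by_cases hx : x ∈ Set.range t
        · rw [ind_of_true hx, ind_of_false (not_not.2 hx)]; linarith [hG1 x]
        · rw [ind_of_false hx, ind_of_true hx]; linarith
      have h3 : ∑ x, ind (x ∈ Set.range t) ≤ l := by
        calc ∑ x, ind (x ∈ Set.range t) ≤ ∑ x, ∑ j, ind (t j = x) := by
              refine Finset.sum_le_sum fun x _ => ?_
              simpa using ind_exists_le Finset.univ fun j => t j = x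
          _ = l := by
              rw [Finset.sum_comm]
              simp [ind]
      rw [Finset.sum_add_distrib] at h2
      have h4 : (l : ℝ) + 1 ≤ k := by exact_mod_cast hl
      linarith
    calc (Q - k) ^ (l + 1) = (Q - k) ^ l * (Q - k) := pow_succ _ _
      _ ≤ (∑ t : Fin l → T, ind (Function.Injective t) * ∏ j, G (t j)) * (Q - k) := by
          refine mul_le_mul_of_nonneg_right (ih (by omega)) (by linarith)
      _ ≤ ∑ t : Fin l → T, (ind (Function.Injective t) * ∏ j, G (t j)) *
            ∑ x, ind (x ∉ Set.range t) * G x := by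
          rw [Finset.sum_mul]
          refine Finset.sum_le_sum fun t _ => mul_le_mul_of_nonneg_left (h1 t) ?_
          exact mul_nonneg (ind_nonneg _) (Finset.prod_nonneg fun _ _ => hG0 _)
      _ = ∑ t : Fin (l + 1) → T, ind (Function.Injective t) * ∏ j, G (t j) := by
          rw [← Equiv.sum_comp (Fin.consEquiv fun _ => T), Fintype.sum_prod_type, Finset.sum_comm]
          refine Finset.sum_congr rfl fun t _ => ?_
          rw [Finset.mul_sum]
          refine Finset.sum_congr rfl fun x _ => ?_
          simp only [Fin.consEquiv, Equiv.coe_fn_mk]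
          rw [ind_congr Fin.cons_injective_iff, ind_and, Fin.prod_univ_succ]
          simp only [Fin.cons_zero, Fin.cons_succ]
          ring

variable {p : ℕ} [Fact p.Prime] {ι : Type*} [Fintype ι] [DecidableEq ι]

/-- The double product is symmetric in a and t, so summing over a turns the frequencies t into steps
of a walk, independently for each i. -/
lemma sum_prod_prod_lazyCos {κ : Type*} [Fintype κ] [DecidableEq κ] (t : κ → ZMod p) :
    ∑ a : ι → ZMod p, ∏ j, ∏ i, lazyCos (t j * a i) =
      (p * walkProb (lazyStep (ZMod p)) t) ^ Fintype.card ι := by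
  rw [lazyProb_eq_sum, ← Finset.card_univ, ← Finset.prod_const, Finset.prod_univ_sum,
    Fintype.piFinset_univ]
  refine Finset.sum_congr rfl fun a _ => ?_
  rw [Finset.prod_comm]
  exact Finset.prod_congr rfl fun i _ => Finset.prod_congr rfl fun j _ => by rw [mul_comm]

/-- Moment bound for the number of vectors `a` modulo `p` for which the random walk with steps
`a i` is more concentrated than the uniform distribution. -/
lemma sum_ind_mul_pow_le {Q : ℝ} (k : ℕ) (hk : k ≤ Q) :
    (∑ a : ι → ZMod p, ind (Q ≤ p * signProb a)) * (Q - k) ^ k ≤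
      p ^ Fintype.card ι * ∑ t : Fin k → ZMod p, ind (Function.Injective t) *
        walkProb (lazyStep (ZMod p)) t ^ Fintype.card ι := by
  rw [Finset.sum_mul]
  calc ∑ a : ι → ZMod p, ind (Q ≤ p * signProb a) * (Q - k) ^ k
      ≤ ∑ a : ι → ZMod p, ∑ t : Fin k → ZMod p, ind (Function.Injective t) *
          ∏ j, ∏ i, lazyCos (t j * a i) := by
        refine Finset.sum_le_sum fun a _ => ?_
        have hnn : ∀ t : ZMod p, 0 ≤ ∏ i, lazyCos (t * a i) := fun t =>
          Finset.prod_nonneg fun _ _ => lazyCos_nonneg _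
        by_cases h : Q ≤ p * signProb a
        · rw [ind_of_true h, one_mul]
          refine pow_le_sum_injective hnn (fun t => ?_) (h.trans (signProb_le_sum_lazyCos a)) k hk
          exact Finset.prod_le_one (fun _ _ => lazyCos_nonneg _) fun _ _ => lazyCos_le_one _
        · rw [ind_of_false h, zero_mul]
          exact Finset.sum_nonneg fun t _ =>
            mul_nonneg (ind_nonneg _) (Finset.prod_nonneg fun _ _ => hnn _)
    _ = _ := by
        rw [Finset.sum_comm, Finset.mul_sum]
        refine Finset.sum_congr rfl fun t _ => ?_
        rw [← Finset.mul_sum, sum_prod_prod_lazyCos, mul_pow]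
        ring

end Moments

/-! ### Kernel vectors: union bounds, Siegel's lemma, reduction modulo primes -/

section Reduction

lemma signProb_int_le_zmod {ι : Type*} [Fintype ι] [DecidableEq ι] (p : ℕ) (v : ι → ℤ) :
    signProb v ≤ signProb (fun i => (v i : ZMod p)) := by
  refine avg_mono fun x => ind_mono fun h => ?_
  have := congrArg (Int.cast : ℤ → ZMod p) h
  simpa using this

/-- A Littlewood–Offord inequality. -/
lemma signProb_int_le {ι : Type*} [Fintype ι] [DecidableEq ι] (v : ι → ℤ) {T : Finset ι}
    (hT0 : T.Nonempty) (hT : ∀ j ∈ T, v j ≠ 0) {m : ℕ} (hm : 0 < m) :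
    signProb v ≤ Real.exp (-(T.card / (8 * m ^ 2))) + 1 / m := by
  refine le_of_forall_pos_le_add fun ε hε => ?_
  obtain ⟨k, hk⟩ := exists_nat_gt (1 / ε)
  -- A prime beyond every |v j| keeps nonzero entries nonzero; beyond k it makes 1/p at most ε.
  obtain ⟨p, hpk, hp⟩ := Nat.exists_infinite_primes (k + 3 + ∑ j, (v j).natAbs)
  have : Fact p.Prime := ⟨hp⟩
  have hv : ∀ j ∈ T, ((v j : ℤ) : ZMod p) ≠ 0 := by
    intro j hj h
    rw [ZMod.intCast_zmod_eq_zero_iff_dvd] at h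
    have h1 := Int.natAbs_dvd_natAbs.2 h
    rw [Int.natAbs_natCast] at h1
    have h2 := Nat.le_of_dvd (Int.natAbs_pos.2 (hT j hj)) h1
    have h3 := Finset.single_le_sum (f := fun j => (v j).natAbs) (fun _ _ => Nat.zero_le _)
      (Finset.mem_univ j)
    omega
  have h1 := (signProb_int_le_zmod p v).trans ((signProb_le_lazyProb _).trans
    (lazyProb_le_of_ne_zero (by omega) hT0 hv hm))
  have h2 : (1 : ℝ) / p ≤ ε := by
    have hkp : (k : ℝ) ≤ p := by exact_mod_cast (by omega : k ≤ p)
    have hp0 : (0 : ℝ) < p := by exact_mod_cast hp.pos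
    rw [div_le_iff₀ hp0]
    rw [div_lt_iff₀ hε] at hk
    nlinarith
  linarith

/-- At a nonzero coordinate of a the sign is determined by the others, and 1 ≠ -1. -/
lemma signProb_le_half {F ι : Type*} [Field F] [Fintype ι] [DecidableEq ι] (h2 : (2 : F) ≠ 0)
    {a : ι → F} (ha : a ≠ 0) : signProb a ≤ 1 / 2 := by
  obtain ⟨j, hj⟩ := Function.ne_iff.1 ha
  have hα : ∀ v : F, avg (fun ε : ℤˣ => ind (((ε : ℤ) : F) = v)) ≤ 1 / 2 := by
    intro v
    simp only [avg]
    rw [show (Finset.univ : Finset ℤˣ) = {1, -1} from rfl,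
      Finset.sum_pair (by decide : (1 : ℤˣ) ≠ -1), Fintype.card_units_int]
    simp only [Units.val_one, Int.cast_one, Units.val_neg, Int.cast_neg]
    by_cases h1 : (1 : F) = v
    · rw [ind_of_false (P := -1 = v)]
      · have := ind_le_one ((1 : F) = v)
        norm_num
        linarith
      · intro h
        apply h2
        linear_combination h1 - h
    · rw [ind_of_false h1]
      have := ind_le_one ((-1 : F) = v)
      norm_num
      linarith
  have := avg_ind_and_eq_le (fun ε : ℤˣ => ((ε : ℤ) : F)) hα j (fun _ => True) (fun _ _ => Iff.rfl)
    (fun y : ι → ℤˣ => -(∑ i ∈ Finset.univ.erase j, ((y i : ℤ) : F) * a i) / a j) (fun y ω => by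
      congr 2
      refine Finset.sum_congr rfl fun i hi => ?_
      rw [Function.update_of_ne (Finset.ne_of_mem_erase hi)])
  simp only [true_and, ind_of_true, avg_const, mul_one] at this
  refine le_trans (avg_mono fun y => ind_mono fun h1 => ?_) this
  rw [← Finset.add_sum_erase _ _ (Finset.mem_univ j)] at h1
  rw [eq_div_iff hj, eq_neg_iff_add_eq_zero, h1]

/-- The probability that all rows of a random sign matrix are orthogonal to `a`. -/
lemma avg_forall_orthogonal {R ι : Type*} [CommRing R] [Fintype ι] [DecidableEq ι] (N : ℕ)
    (a : ι → R) :
    avg (fun M : Fin N → ι → ℤˣ => ind (∀ l, ∑ i, ((M l i : ℤ) : R) * a i = 0)) =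
      signProb a ^ N := by
  rw [avg_ind_forall (fun x : ι → ℤˣ => ∑ i, ((x i : ℤ) : R) * a i = 0), Fintype.card_fin]
  rfl

lemma avg_exists_orthogonal_le {R ι : Type*} [CommRing R] [Fintype R] [Fintype ι] [DecidableEq ι]
    (N : ℕ) (P : (ι → R) → Prop) :
    avg (fun M : Fin N → ι → ℤˣ => ind (∃ a, P a ∧ ∀ l, ∑ i, ((M l i : ℤ) : R) * a i = 0)) ≤
      ∑ a, ind (P a) * signProb a ^ N := by
  calc _ ≤ avg (fun M : Fin N → ι → ℤˣ => ∑ a : ι → R,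
          ind (P a) * ind (∀ l, ∑ i, ((M l i : ℤ) : R) * a i = 0)) := by
        refine avg_mono fun M => ?_
        simp only [← ind_and]
        simpa using ind_exists_le Finset.univ
          fun a => P a ∧ ∀ l, ∑ i, ((M l i : ℤ) : R) * a i = 0
    _ = _ := by
        rw [avg_sum]
        refine Finset.sum_congr rfl fun a _ => ?_
        rw [avg_mul_left, avg_forall_orthogonal]

open Classical in
/-- The size of the support. -/
noncomputable def suppCard {ι R : Type*} [Fintype ι] [Zero R] (a : ι → R) : ℕ :=
  (Finset.univ.filter fun i => a i ≠ 0).card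

lemma sum_pow_suppCard (n : ℕ) (x : ℝ) :
    ∑ a : Fin n → ZMod 3, x ^ suppCard a = (1 + 2 * x) ^ n := by
  classical
  have h : ∀ a : Fin n → ZMod 3, x ^ suppCard a = ∏ i, if a i ≠ 0 then x else 1 := by
    intro a
    rw [suppCard, Finset.prod_ite]
    simp
  simp_rw [h]
  have := Finset.prod_univ_sum (fun _ : Fin n => (Finset.univ : Finset (ZMod 3)))
    (fun _ b => if b ≠ 0 then x else 1)
  rw [Fintype.piFinset_univ] at this
  rw [← this, Finset.prod_const, Finset.card_univ, Fintype.card_fin]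
  congr 1
  rw [show (Finset.univ : Finset (ZMod 3)) = {0, 1, 2} from rfl,
    Finset.sum_insert (by decide), Finset.sum_pair (by decide)]
  rw [if_neg (by simp), if_pos (by decide), if_pos (by decide)]
  ring

/-- Random sign matrices rarely have sparse kernel vectors modulo `3`. -/
lemma avg_exists_sparse_le (N n s : ℕ) {x : ℝ} (hx : 0 < x) (hx1 : x ≤ 1) :
    avg (fun M : Fin N → Fin n → ℤˣ => ind (∃ a : Fin n → ZMod 3, (a ≠ 0 ∧ suppCard a ≤ s) ∧
      ∀ l, ∑ i, ((M l i : ℤ) : ZMod 3) * a i = 0)) ≤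
      (1 / 2) ^ N * ((1 + 2 * x) ^ n / x ^ s) := by
  refine (avg_exists_orthogonal_le N _).trans ?_
  rw [← sum_pow_suppCard, Finset.sum_div, Finset.mul_sum]
  refine Finset.sum_le_sum fun a _ => ?_
  by_cases h : a ≠ 0 ∧ suppCard a ≤ s
  · rw [ind_of_true h, one_mul]
    -- Rankin's trick: this weight dominates the indicator of small support and sums in closed form.
    have h1 : 1 ≤ x ^ suppCard a / x ^ s := by
      rw [one_le_div (by positivity)]
      exact pow_le_pow_of_le_one hx.le hx1 h.2
    calc signProb a ^ N ≤ (1 / 2) ^ N := by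
          refine pow_le_pow_left₀ (walkProb_nonneg _ _) (signProb_le_half (by decide) h.1) N
      _ ≤ _ := le_mul_of_one_le_right (by positivity) h1
  · rw [ind_of_false h, zero_mul]
    positivity

/-- Random sign matrices rarely have kernel vectors modulo `p` of prescribed concentration. -/
lemma avg_exists_concentrated_le {p : ℕ} [Fact p.Prime] (hp2 : p ≠ 2) {N k m₁ m₂ : ℕ}
    {Q Q' β : ℝ} (hQ' : 0 ≤ Q') (hk : 2 ≤ k) (hQ : k + 1 ≤ Q) (hβ0 : 0 ≤ β) (hβ1 : β ≤ 1)
    (hβ : ∀ t : Fin k → ZMod p, Function.Injective t → walkProb (lazyStep (ZMod p)) t ≤ β)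
    (hn : m₁ + m₂ + k ≤ N + 1) (hm₁ : p * (3 / 4 : ℝ) ^ m₁ ≤ 1) :
    avg (fun M : Fin N → Fin (N + 1) → ℤˣ => ind (∃ a : Fin (N + 1) → ZMod p,
      (Q ≤ p * signProb a ∧ p * signProb a ≤ Q') ∧
        ∀ l, ∑ i, ((M l i : ℤ) : ZMod p) * a i = 0)) ≤
      p * (2 ^ (N + 1) * β ^ m₂) * Q' ^ N := by
  classical
  have hp0 : (0 : ℝ) < p := by exact_mod_cast (Fact.out : p.Prime).pos
  refine (avg_exists_orthogonal_le N _).trans ?_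
  have h1 : ∑ a : Fin (N + 1) → ZMod p, ind (Q ≤ p * signProb a ∧ p * signProb a ≤ Q') *
      signProb a ^ N ≤ (∑ a : Fin (N + 1) → ZMod p, ind (Q ≤ p * signProb a)) * (Q' / p) ^ N := by
    rw [Finset.sum_mul]
    refine Finset.sum_le_sum fun a _ => ?_
    by_cases h : Q ≤ p * signProb a ∧ p * signProb a ≤ Q'
    · rw [ind_of_true h, ind_of_true h.1, one_mul, one_mul]
      refine pow_le_pow_left₀ (walkProb_nonneg _ _) ?_ N
      rw [le_div_iff₀ hp0, mul_comm]
      exact h.2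
    · rw [ind_of_false h, zero_mul]
      exact mul_nonneg (ind_nonneg _) (by positivity)
  have h2 : (∑ a : Fin (N + 1) → ZMod p, ind (Q ≤ p * signProb a)) ≤
      p ^ (N + 1) * (2 ^ (N + 1) * β ^ m₂) := by
    have h3 := sum_ind_mul_pow_le (p := p) (ι := Fin (N + 1)) (Q := Q) k (by linarith)
    -- The moment factor itself is discarded.
    have h4 : 1 ≤ (Q - k) ^ k := one_le_pow₀ (by linarith)
    refine (le_mul_of_one_le_right (Finset.sum_nonneg fun _ _ => ind_nonneg _) h4).trans
      (h3.trans ?_)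
    rw [Fintype.card_fin]
    gcongr
    have h5 := sum_walkProb_pow_le (lazyStep (ZMod p)) (avg_lazyStep_le hp2) (by norm_num) hβ0 hβ1
      (Finset.univ.filter fun t : Fin k → ZMod p => Function.Injective t) (fun h => ?_)
      (fun t ht => hβ t (Finset.mem_filter.1 ht).2) (n := N + 1) (m₁ := m₁) (m₂ := m₂)
      (by simpa using hn) (by simpa [ZMod.card] using hm₁)
    · refine le_trans (le_of_eq ?_) h5
      rw [Finset.sum_filter]
      refine Finset.sum_congr rfl fun t _ => ?_
      split_ifs with h
      · rw [ind_of_true h, one_mul]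
      · rw [ind_of_false h, zero_mul]
    · have := (Finset.mem_filter.1 h).2 (show (0 : Fin k → ZMod p) ⟨0, by omega⟩ =
        (0 : Fin k → ZMod p) ⟨1, by omega⟩ from rfl)
      simp at this
  -- With N + 1 columns but N rows, one factor p survives.
  refine h1.trans ((mul_le_mul_of_nonneg_right h2 (by positivity)).trans_eq ?_)
  rw [div_pow, pow_succ]
  field_simp

/-- Siegel's lemma for sign matrices. -/
lemma exists_kernel_vector {N : ℕ} (hN : 0 < N) (M : Fin N → Fin (N + 1) → ℤˣ) :
    ∃ v : Fin (N + 1) → ℤ, (∃ i, ¬ (3 : ℤ) ∣ v i) ∧ (∀ i, |v i| ≤ (N + 1 : ℤ) ^ N) ∧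
      ∀ l, ∑ i, (M l i : ℤ) * v i = 0 := by
  classical
  let _ : SeminormedAddCommGroup (Matrix (Fin N) (Fin (N + 1)) ℤ) := Matrix.seminormedAddCommGroup
  obtain ⟨w, hw0, hw, hnorm⟩ := Int.Matrix.exists_ne_zero_int_vec_norm_le
    (Matrix.of fun l i => (M l i : ℤ)) (by simp) (by simpa using hN)
  have hA : ‖Matrix.of fun l i => (M l i : ℤ)‖ ≤ 1 := by
    rw [Matrix.norm_le_iff zero_le_one]
    intro l i
    rcases Int.units_eq_one_or (M l i) with h | h <;> simp [h]
  rw [max_eq_left hA, Fintype.card_fin, Fintype.card_fin, mul_one] at hnorm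
  have hexp : (N : ℝ) / (((N + 1 : ℕ) : ℝ) - N) = N := by push_cast; simp
  rw [hexp, Real.rpow_natCast] at hnorm
  have hwi : ∀ i, |w i| ≤ (N + 1 : ℤ) ^ N := by
    intro i
    have h1 := (norm_le_pi_norm w i).trans hnorm
    rw [Int.norm_eq_abs] at h1
    exact_mod_cast h1
  -- Dividing by the gcd leaves some entry prime to 3 and does not enlarge entries.
  obtain ⟨g, hg, hg1⟩ := Finset.extract_gcd w (Finset.univ_nonempty (α := Fin (N + 1)))
  set d := Finset.univ.gcd w
  have hd0 : d ≠ 0 := by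
    intro h
    rw [Finset.gcd_eq_zero_iff] at h
    exact hw0 (funext fun i => h i (Finset.mem_univ i))
  refine ⟨g, ?_, fun i => ?_, fun l => ?_⟩
  · by_contra! h
    have h3 : (3 : ℤ) ∣ Finset.univ.gcd g := Finset.dvd_gcd fun i _ => h i
    rw [hg1] at h3
    norm_num at h3
  · refine le_trans ?_ (hwi i)
    rw [hg i (Finset.mem_univ i), abs_mul]
    exact le_mul_of_one_le_left (abs_nonneg _) (Int.one_le_abs hd0)
  · have h1 := congrFun hw l
    simp only [Matrix.mulVec, dotProduct, Matrix.of_apply, Pi.zero_apply] at h1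
    have h2 : d * ∑ i, (M l i : ℤ) * g i = 0 := by
      rw [← h1, Finset.mul_sum]
      refine Finset.sum_congr rfl fun i hi => ?_
      rw [hg i hi]
      ring
    exact (mul_eq_zero.1 h2).resolve_left hd0

lemma sum_log_primes_dvd_le {s : Finset ℕ} (hs : ∀ p ∈ s, p.Prime) {S : ℤ} (hS : S ≠ 0) :
    ∑ p ∈ s, Real.log p * ind ((p : ℤ) ∣ S) ≤ Real.log |S| := by
  classical
  have h1 : ∑ p ∈ s, Real.log p * ind ((p : ℤ) ∣ S) =
      ∑ p ∈ s.filter (fun p => p ∣ S.natAbs), Real.log p := by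
    rw [Finset.sum_filter]
    refine Finset.sum_congr rfl fun p _ => ?_
    rw [ind_congr Int.natCast_dvd]
    split_ifs with h
    · rw [ind_of_true h, mul_one]
    · rw [ind_of_false h, mul_zero]
  have h2 : ∏ p ∈ s.filter (fun p => p ∣ S.natAbs), p ∣ S.natAbs :=
    Finset.prod_primes_dvd _ (fun p hp => (hs p (Finset.mem_filter.1 hp).1).prime)
      fun p hp => (Finset.mem_filter.1 hp).2
  have h3 := Nat.le_of_dvd (Int.natAbs_pos.2 hS) h2
  have hpos : ∀ p ∈ s.filter (fun p => p ∣ S.natAbs), (p : ℝ) ≠ 0 := fun p hp => by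
    exact_mod_cast (hs p (Finset.mem_filter.1 hp).1).ne_zero
  rw [h1, ← Real.log_prod hpos]
  refine Real.log_le_log ?_ ?_
  · exact Finset.prod_pos fun p hp => by
      exact_mod_cast (hs p (Finset.mem_filter.1 hp).1).pos
  · rw [← Int.cast_abs, ← Nat.cast_natAbs, ← Nat.cast_prod]
    exact_mod_cast h3

/-- The primes in `(x, 4x]`. -/
noncomputable def primeWindow (x : ℝ) : Finset ℕ :=
  (Finset.Ioc ⌊x⌋₊ ⌊4 * x⌋₊).filter Nat.Prime

lemma sum_log_primeWindow {x : ℝ} (hx : 0 ≤ x) :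
    ∑ p ∈ primeWindow x, Real.log p = Chebyshev.theta (4 * x) - Chebyshev.theta x := by
  have h : ⌊x⌋₊ ≤ ⌊4 * x⌋₊ := Nat.floor_le_floor (by linarith)
  rw [Chebyshev.theta, Chebyshev.theta, eq_sub_iff_add_eq', primeWindow,
    ← Finset.Ioc_union_Ioc_eq_Ioc (Nat.zero_le _) h, Finset.filter_union, Finset.sum_union]
  exact Finset.disjoint_filter_filter (Finset.Ioc_disjoint_Ioc_of_le le_rfl)

/-- Reduction modulo a suitable prime does not increase the concentration much. -/
lemma exists_prime_signProb_le {ι : Type*} [Fintype ι] [DecidableEq ι] (v : ι → ℤ) {H : ℝ}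
    (hH : ∀ x : ι → ℤˣ, |((∑ i, (x i : ℤ) * v i : ℤ) : ℝ)| ≤ H) (hH1 : 1 ≤ H) {x : ℝ} (hx : 0 < x)
    (hθ : x ≤ Chebyshev.theta (4 * x) - Chebyshev.theta x) :
    ∃ p : ℕ, p.Prime ∧ x < p ∧ p ≤ 4 * x ∧
      signProb (fun i => (v i : ZMod p)) ≤ signProb v + Real.log H / x := by
  rw [← sum_log_primeWindow hx.le] at hθ
  have hprime : ∀ p ∈ primeWindow x, p.Prime := fun p hp => (Finset.mem_filter.1 hp).2
  have hlog : ∀ p ∈ primeWindow x, 0 < Real.log p := fun p hp =>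
    Real.log_pos (by exact_mod_cast (hprime p hp).one_lt)
  have hlogH : 0 ≤ Real.log H := Real.log_nonneg hH1
  -- The excess modulo p is the probability that p divides a nonzero value S of the sum; the primes
  -- dividing S have total weight at most log |S| ≤ log H.
  have h1 : ∑ p ∈ primeWindow x, Real.log p * (signProb (fun i => (v i : ZMod p)) - signProb v) ≤
      Real.log H := by
    calc ∑ p ∈ primeWindow x, Real.log p * (signProb (fun i => (v i : ZMod p)) - signProb v)
        = avg fun y : ι → ℤˣ => ∑ p ∈ primeWindow x, Real.log p *
            (ind ((p : ℤ) ∣ ∑ i, (y i : ℤ) * v i) + (-1) * ind (∑ i, (y i : ℤ) * v i = 0)) := by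
          rw [avg_sum]
          refine Finset.sum_congr rfl fun p _ => ?_
          rw [avg_mul_left, avg_add, avg_mul_left, sub_eq_add_neg, neg_one_mul]
          congr 3
          simp only [signProb, walkProb]
          congr 1
          ext y
          refine ind_congr ?_
          rw [← ZMod.intCast_zmod_eq_zero_iff_dvd]
          push_cast
          rfl
      _ ≤ Real.log H := by
          refine avg_le_of_le fun y => ?_
          by_cases hS : ∑ i, (y i : ℤ) * v i = 0
          · rw [Finset.sum_eq_zero fun p _ => ?_]
            · exact hlogH
            · rw [hS, ind_of_true (dvd_zero _), ind_of_true rfl]; ring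
          · rw [ind_of_false hS]
            simp only [mul_zero, add_zero]
            refine (sum_log_primes_dvd_le hprime hS).trans (Real.log_le_log ?_ (hH y))
            exact abs_pos.2 (by exact_mod_cast hS)
  by_contra! hcon
  have hne : (primeWindow x).Nonempty := by
    by_contra h
    rw [Finset.not_nonempty_iff_eq_empty.1 h, Finset.sum_empty] at hθ
    linarith
  have h2 : ∑ p ∈ primeWindow x, Real.log p * (Real.log H / x) <
      ∑ p ∈ primeWindow x, Real.log p * (signProb (fun i => (v i : ZMod p)) - signProb v) := by
    refine Finset.sum_lt_sum_of_nonempty hne fun p hp => ?_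
    refine mul_lt_mul_of_pos_left ?_ (hlog p hp)
    have hp' := Finset.mem_Ioc.1 (Finset.mem_filter.1 hp).1
    have := hcon p (hprime p hp) ((Nat.floor_lt hx.le).1 hp'.1)
      ((Nat.le_floor_iff (by linarith)).1 hp'.2)
    linarith
  rw [← Finset.sum_mul] at h2
  have h3 : Real.log H ≤ (∑ p ∈ primeWindow x, Real.log p) * (Real.log H / x) := by
    calc Real.log H = x * (Real.log H / x) := by field_simp
      _ ≤ _ := mul_le_mul_of_nonneg_right hθ (by positivity)
  linarith

end Reduction

/-! ### From singularity to concentrated kernel vectors -/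

section Singularity

/-- The real matrix with the given signs as entries. -/
def realMatrix {n : ℕ} (A : Fin n → Fin n → ℤˣ) : Fin n → Fin n → ℝ := fun i j => ((A i j : ℤ) : ℝ)

lemma realMatrix_injective {n : ℕ} : Function.Injective (realMatrix (n := n)) := by
  intro A B h
  funext i j
  have h1 := congrFun (congrFun h i) j
  simp only [realMatrix] at h1
  exact Units.ext (by exact_mod_cast h1)

lemma range_realMatrix (n : ℕ) : Set.range (realMatrix (n := n)) = signMatrices n := by
  ext A
  constructor
  · rintro ⟨B, rfl⟩ i j
    rcases Int.units_eq_one_or (B i j) with h | h <;> simp [realMatrix, h]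
  · intro hA
    refine ⟨fun i j => if A i j = 1 then 1 else -1, ?_⟩
    funext i j
    simp only [realMatrix]
    split_ifs with h
    · simp [h]
    · simp [(hA i j).resolve_left h]

lemma singularProb_eq_avg (n : ℕ) :
    singularProb n = avg fun A : Fin n → Fin n → ℤˣ =>
      ind ((Matrix.of (realMatrix A)).det = 0) := by
  classical
  set S : Finset (Fin n → Fin n → ℝ) := Finset.univ.image realMatrix with hS
  have hS' : signMatrices n = S := by
    rw [← range_realMatrix, hS, Finset.coe_image, Finset.coe_univ, Set.image_univ]
  set T : Finset (Fin n → Fin n → ℝ) :=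
    (Finset.univ.filter fun A => (Matrix.of (realMatrix A)).det = 0).image realMatrix with hT
  have hST : (S : Set (Fin n → Fin n → ℝ)) ∩ {A | (Matrix.of A).det = 0} = T := by
    ext A
    simp only [hS, hT, Finset.coe_image, Finset.coe_univ, Set.image_univ, Set.mem_inter_iff,
      Set.mem_range, Set.mem_ofPred_eq, Finset.coe_filter, Finset.mem_univ, true_and, Set.mem_image]
    constructor
    · rintro ⟨⟨B, rfl⟩, h⟩
      exact ⟨B, h, rfl⟩
    · rintro ⟨B, h, rfl⟩
      exact ⟨⟨B, rfl⟩, h⟩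
  have hTS : S ∩ T = T := by
    rw [Finset.inter_eq_right]
    exact Finset.image_subset_image (Finset.filter_subset _ _)
  rw [singularProb, MeasureTheory.measureReal_def, hS',
    ← uniformOn_inter_self (Finset.finite_toSet S), hST, uniformOn_apply_finset, hTS, hS, hT,
    Finset.card_image_of_injective _ realMatrix_injective,
    Finset.card_image_of_injective _ realMatrix_injective, avg, ENNReal.toReal_div,
    ENNReal.toReal_natCast, ENNReal.toReal_natCast, Finset.card_univ]
  congr 1
  rw [Finset.card_filter, Nat.cast_sum]
  refine Finset.sum_congr rfl fun A _ => ?_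
  split_ifs with h <;> simp [ind, h]

lemma avg_row_orthogonal {N : ℕ} (i : Fin (N + 1))
    (v : (Fin N → Fin (N + 1) → ℤˣ) → Fin (N + 1) → ℤ) :
    avg (fun A : Fin (N + 1) → Fin (N + 1) → ℤˣ =>
      ind (∑ j, (A i j : ℤ) * v (fun l => A (i.succAbove l)) j = 0)) =
      avg fun M => signProb (v M) := by
  rw [← avg_equiv (Fin.insertNthEquiv (fun _ => Fin (N + 1) → ℤˣ) i), avg_prod, avg_comm]
  simp [signProb, walkProb, Fin.insertNthEquiv]

/-- A singular matrix has a row in the span of the others. -/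
lemma singularProb_succ_le_avg {N : ℕ} (v : (Fin N → Fin (N + 1) → ℤˣ) → Fin (N + 1) → ℤ)
    (hv : ∀ M l, ∑ j, (M l j : ℤ) * v M j = 0) :
    singularProb (N + 1) ≤ (N + 1) * avg fun M => signProb (v M) := by
  rw [singularProb_eq_avg]
  calc _ ≤ avg (fun A : Fin (N + 1) → Fin (N + 1) → ℤˣ =>
        ∑ i, ind (∑ j, (A i j : ℤ) * v (fun l => A (i.succAbove l)) j = 0)) := by
        refine avg_mono fun A => ?_
        refine (ind_mono ?_).trans (ind_exists_le Finset.univ _)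
        intro h
        obtain ⟨u, hu0, hu⟩ := Matrix.exists_vecMul_eq_zero_iff.2 h
        obtain ⟨i, hi⟩ := Function.ne_iff.1 hu0
        refine ⟨i, Finset.mem_univ i, ?_⟩
        set w := v fun l => A (i.succAbove l)
        -- Pair the left kernel relation with w: every row but i is orthogonal to w, and u i ≠ 0.
        have h1 : ∑ k, u k * ∑ j, ((A k j : ℤ) : ℝ) * w j = 0 := by
          simp_rw [Finset.mul_sum]
          rw [Finset.sum_comm]
          refine Finset.sum_eq_zero fun j _ => ?_
          have := congrFun hu j
          simp only [Matrix.vecMul, dotProduct, Matrix.of_apply, realMatrix, Pi.zero_apply] at this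
          rw [← zero_mul ((w j : ℤ) : ℝ), ← this, Finset.sum_mul]
          exact Finset.sum_congr rfl fun k _ => by ring
        have h2 : ∑ l, u (i.succAbove l) * ∑ j, ((A (i.succAbove l) j : ℤ) : ℝ) * w j = 0 := by
          refine Finset.sum_eq_zero fun l _ => ?_
          have h3 : ∑ j, ((A (i.succAbove l) j : ℤ) : ℝ) * w j = 0 := by
            exact_mod_cast hv (fun l => A (i.succAbove l)) l
          rw [h3, mul_zero]
        rw [Fin.sum_univ_succAbove _ i, h2, add_zero] at h1
        exact_mod_cast (mul_eq_zero.1 h1).resolve_left hi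
    _ = _ := by
        rw [avg_sum]
        simp_rw [avg_row_orthogonal]
        simp

lemma abs_sum_le_pow {N : ℕ} {v : Fin (N + 1) → ℤ} (hv : ∀ i, |v i| ≤ (N + 1 : ℤ) ^ N)
    (x : Fin (N + 1) → ℤˣ) : |((∑ i, (x i : ℤ) * v i : ℤ) : ℝ)| ≤ (N + 1 : ℝ) ^ (N + 1) := by
  have h : |∑ i, (x i : ℤ) * v i| ≤ (N + 1 : ℤ) ^ (N + 1) := by
    refine (Finset.abs_sum_le_sum_abs _ _).trans ?_
    have h1 : ∀ i ∈ Finset.univ, |(x i : ℤ) * v i| ≤ (N + 1 : ℤ) ^ N := by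
      intro i _
      rw [abs_mul]
      rcases Int.units_eq_one_or (x i) with h | h <;> simpa [h] using hv i
    refine (Finset.sum_le_card_nsmul _ _ _ h1).trans_eq ?_
    simp [pow_succ']
  exact_mod_cast h

/-- The event that a matrix has a kernel vector modulo `p` of prescribed concentration. -/
def HasConcentratedKernel {N : ℕ} (M : Fin N → Fin (N + 1) → ℤˣ) (Q : ℝ) (p : ℕ) : Prop :=
  ∃ a : Fin (N + 1) → ZMod p, (Q ≤ p * signProb a ∧ p * signProb a ≤ 8 * Q) ∧
    ∀ l, ∑ i, ((M l i : ℤ) : ZMod p) * a i = 0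

/-- Reduction cannot lower the probability q, so p > Q/q gives the lower end of the window. The
error log H/(Q/q) is at most q, so p ≤ 4Q/q gives the upper end 4 · 2 · Q. -/
lemma exists_hasConcentratedKernel {N : ℕ} {M : Fin N → Fin (N + 1) → ℤˣ} {v : Fin (N + 1) → ℤ}
    (hM : ∀ l, ∑ i, (M l i : ℤ) * v i = 0) (hv : ∀ i, |v i| ≤ (N + 1 : ℤ) ^ N)
    {Q : ℝ} (hQ0 : 0 < Q) (hlogQ : Real.log ((N + 1) ^ (N + 1)) ≤ Q)
    (hθ : ∀ x ≥ Q, x ≤ Chebyshev.theta (4 * x) - Chebyshev.theta x) (hq : 0 < signProb v) :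
    ∃ p : ℕ, p.Prime ∧ Q / signProb v < p ∧ p ≤ 4 * (Q / signProb v) ∧
      HasConcentratedKernel M Q p := by
  set q := signProb v
  have hq1 : q ≤ 1 := walkProb_le_one _ _
  have hx : 0 < Q / q := by positivity
  obtain ⟨p, hp, hxp, hpx, hpq⟩ := exists_prime_signProb_le v (abs_sum_le_pow hv)
    (one_le_pow₀ (by linarith [(Nat.cast_nonneg N : (0 : ℝ) ≤ N)])) hx
    (hθ _ (by rw [ge_iff_le, le_div_iff₀ hq]; nlinarith))
  have h1 : Real.log ((N + 1) ^ (N + 1)) / (Q / q) ≤ q := by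
    rw [div_le_iff₀ hx]
    calc _ ≤ Q := hlogQ
      _ = q * (Q / q) := by field_simp
  refine ⟨p, hp, hxp, hpx, fun i => (v i : ZMod p), ⟨?_, ?_⟩, fun l => ?_⟩
  · rw [div_lt_iff₀ hq] at hxp
    refine hxp.le.trans (mul_le_mul_of_nonneg_left (signProb_int_le_zmod p v) (Nat.cast_nonneg p))
  · calc (p : ℝ) * signProb (fun i => (v i : ZMod p)) ≤ 4 * (Q / q) * (2 * q) := by
          refine mul_le_mul hpx ?_ (walkProb_nonneg _ _) (by positivity)
          linarith
      _ = 8 * Q := by field_simp; norm_num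
  · have := congrArg (Int.cast : ℤ → ZMod p) (hM l)
    simpa using this

lemma suppCard_cast_le {n : ℕ} (v : Fin n → ℤ) :
    suppCard (fun i => (v i : ZMod 3)) ≤ suppCard v := by
  classical
  refine Finset.card_le_card fun i hi => ?_
  simp only [Finset.mem_filter, Finset.mem_univ, true_and] at hi ⊢
  intro h
  simp [h] at hi

open Classical in
/-- A bound for the singularity probability in terms of the parameters of the proof. -/
lemma singularProb_succ_le {N k m₁ m₂ s : ℕ} {Q q₀ q₁ β : ℝ} (hN : 0 < N) (hq₀ : 0 < q₀)
    (hLO : ∀ v : Fin (N + 1) → ℤ, s < suppCard v → signProb v ≤ q₁)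
    (hQ : 2 ≤ Q) (hk : 2 ≤ k) (hQk : k + 1 ≤ Q) (hlogQ : Real.log ((N + 1) ^ (N + 1)) ≤ Q)
    (hθ : ∀ x ≥ Q, x ≤ Chebyshev.theta (4 * x) - Chebyshev.theta x)
    (hβ0 : 0 ≤ β) (hβ1 : β ≤ 1)
    (hβ : ∀ (p : ℕ) [Fact p.Prime], p ≠ 2 → Q / q₁ ≤ p → ∀ t : Fin k → ZMod p,
      Function.Injective t → walkProb (lazyStep (ZMod p)) t ≤ β)
    (hn : m₁ + m₂ + k ≤ N + 1) (hm₁ : 4 * Q / q₀ * (3 / 4 : ℝ) ^ m₁ ≤ 1) :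
    singularProb (N + 1) ≤ (N + 1) * (q₀ + (1 / 2) ^ N *
      ((1 + 2 * (1 / 50)) ^ (N + 1) / (1 / 50) ^ s) +
      4 * Q / q₀ * (4 * Q / q₀ * (2 ^ (N + 1) * β ^ m₂) * (8 * Q) ^ N)) := by
  choose v hv3 hvH hvM using fun M => exists_kernel_vector hN M
  refine (singularProb_succ_le_avg v hvM).trans ?_
  refine mul_le_mul_of_nonneg_left ?_ (by positivity)
  -- All primes the third case can produce, counted crudely by the length of the interval.
  set P : Finset ℕ := (Finset.Icc 1 ⌊4 * Q / q₀⌋₊).filter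
    fun p => p.Prime ∧ p ≠ 2 ∧ Q / q₁ ≤ p with hP
  have hcard : (P.card : ℝ) ≤ 4 * Q / q₀ := by
    refine le_trans ?_ (Nat.floor_le (by positivity))
    exact_mod_cast (Finset.card_filter_le _ _).trans (by simp)
  have hpoint : ∀ M : Fin N → Fin (N + 1) → ℤˣ, signProb (v M) ≤ q₀ +
      ind (∃ a : Fin (N + 1) → ZMod 3, (a ≠ 0 ∧ suppCard a ≤ s) ∧
        ∀ l, ∑ i, ((M l i : ℤ) : ZMod 3) * a i = 0) +
      ∑ p ∈ P, ind (HasConcentratedKernel M Q p) := by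
    intro M
    have hsum : 0 ≤ ∑ p ∈ P, ind (HasConcentratedKernel M Q p) :=
      Finset.sum_nonneg fun _ _ => ind_nonneg _
    have hq1 : signProb (v M) ≤ 1 := walkProb_le_one _ _
    rcases le_or_gt (signProb (v M)) q₀ with hq | hq
    · have := ind_nonneg (∃ a : Fin (N + 1) → ZMod 3, (a ≠ 0 ∧ suppCard a ≤ s) ∧
        ∀ l, ∑ i, ((M l i : ℤ) : ZMod 3) * a i = 0)
      linarith
    rcases le_or_gt (suppCard (v M)) s with hs | hs
    · rw [ind_of_true]
      · linarith
      · obtain ⟨i, hi⟩ := hv3 M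
        refine ⟨fun i => (v M i : ZMod 3), ⟨fun h => hi ?_, (suppCard_cast_le _).trans hs⟩,
          fun l => ?_⟩
        · exact (ZMod.intCast_zmod_eq_zero_iff_dvd _ 3).1 (congrFun h i)
        · have := congrArg (Int.cast : ℤ → ZMod 3) (hvM M l)
          simpa using this
    · have hLOM := hLO _ hs
      have hpos := hq₀.trans hq
      obtain ⟨p, hp, hxp, hpx, hE⟩ :=
        exists_hasConcentratedKernel (hvM M) (hvH M) (by linarith) hlogQ hθ hpos
      have hQp : Q < p := lt_of_le_of_lt (by rw [le_div_iff₀ hpos]; nlinarith) hxp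
      have hmem : p ∈ P := by
        rw [hP, Finset.mem_filter, Finset.mem_Icc]
        refine ⟨⟨hp.one_lt.le, Nat.le_floor (hpx.trans ?_)⟩, hp, ?_, le_trans ?_ hxp.le⟩
        · rw [mul_div_assoc]
          gcongr
        · rintro rfl
          norm_num at hQp
          linarith
        · gcongr
      have h1 := Finset.single_le_sum (f := fun p => ind (HasConcentratedKernel M Q p))
        (fun _ _ => ind_nonneg _) hmem
      simp only [ind_of_true hE] at h1
      have := ind_nonneg (∃ a : Fin (N + 1) → ZMod 3, (a ≠ 0 ∧ suppCard a ≤ s) ∧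
        ∀ l, ∑ i, ((M l i : ℤ) : ZMod 3) * a i = 0)
      linarith
  refine (avg_mono hpoint).trans ?_
  rw [avg_add, avg_add, avg_const, avg_sum]
  refine add_le_add (add_le_add le_rfl ?_) ?_
  · exact avg_exists_sparse_le N (N + 1) s (by norm_num) (by norm_num)
  · have h1 : ∀ p ∈ P, avg (fun M : Fin N → Fin (N + 1) → ℤˣ => ind (HasConcentratedKernel M Q p)) ≤
        4 * Q / q₀ * (2 ^ (N + 1) * β ^ m₂) * (8 * Q) ^ N := by
      intro p hp
      rw [hP, Finset.mem_filter, Finset.mem_Icc] at hp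
      obtain ⟨⟨-, hpQ⟩, hpp, hp2, hpq⟩ := hp
      have : Fact p.Prime := ⟨hpp⟩
      have hpQ' : (p : ℝ) ≤ 4 * Q / q₀ := (Nat.le_floor_iff (by positivity)).1 hpQ
      refine (avg_exists_concentrated_le hp2 (by linarith) hk hQk hβ0 hβ1 (hβ p hp2 hpq) hn
        ((mul_le_mul_of_nonneg_right hpQ' (by positivity)).trans hm₁)).trans ?_
      gcongr
    refine (Finset.sum_le_card_nsmul _ _ _ h1).trans ?_
    rw [nsmul_eq_mul]
    gcongr

end Singularity

/-! ### Choice of parameters for large n -/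

section Asymptotics

/-- The Chebyshev bounds used have constants log 2 below and 2 log 2 above. A window (x, 2x] would
leave no main term; the factor 4 leaves 2 log 2 > 1. -/
lemma eventually_le_theta_sub :
    ∀ᶠ x : ℝ in atTop, x ≤ Chebyshev.theta (4 * x) - Chebyshev.theta x := by
  have h1 : ∀ᶠ y : ℝ in atTop, Real.log y ≤ 0.01 * √y := by
    filter_upwards [(isLittleO_log_rpow_atTop (by norm_num : (0 : ℝ) < 1 / 2)).bound
      (by norm_num : (0 : ℝ) < 0.01), eventually_ge_atTop 1] with y hy hy1
    rw [← Real.sqrt_eq_rpow, Real.norm_of_nonneg (Real.log_nonneg hy1),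
      Real.norm_of_nonneg (Real.sqrt_nonneg y)] at hy
    exact hy
  have h4 : Tendsto (fun x : ℝ => 4 * x) atTop atTop :=
    tendsto_id.const_mul_atTop (by norm_num)
  have h42 : Tendsto (fun x : ℝ => 4 * x + 2) atTop atTop :=
    tendsto_atTop_add_const_right _ _ h4
  filter_upwards [h4.eventually h1, h42.eventually h1, eventually_ge_atTop 100] with x hx hx' hx0
  have h5 := Chebyshev.theta_ge' (x := 4 * x) (by linarith)
  have h6 := Chebyshev.theta_le_log4_mul_x (x := x) (by linarith)
  have hlog4 : Real.log 4 = 2 * Real.log 2 := by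
    rw [show (4 : ℝ) = 2 ^ 2 by norm_num, Real.log_pow]; norm_num
  rw [hlog4] at h6
  have h7 := Real.log_two_gt_d9
  have h8 := Real.log_two_lt_d9
  have h9 : √(4 * x + 2) ≤ 4 * x + 2 := by
    rw [Real.sqrt_le_left (by linarith)]
    nlinarith
  have h10 : √(4 * x) * Real.log (4 * x) ≤ 0.01 * (4 * x) := by
    calc √(4 * x) * Real.log (4 * x) ≤ √(4 * x) * (0.01 * √(4 * x)) := by gcongr
      _ = 0.01 * (√(4 * x) * √(4 * x)) := by ring
      _ = 0.01 * (4 * x) := by rw [Real.mul_self_sqrt (by linarith)]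
  nlinarith

lemma eventually_log_le_rpow {c r : ℝ} (hc : 0 < c) (hr : 0 < r) :
    ∀ᶠ x : ℝ in atTop, Real.log x ≤ c * x ^ r := by
  filter_upwards [(isLittleO_log_rpow_atTop hr).bound hc, eventually_ge_atTop 1] with x hx hx1
  rwa [Real.norm_of_nonneg (Real.log_nonneg hx1),
    Real.norm_of_nonneg (Real.rpow_nonneg (by linarith) r)] at hx

/-- The exponent has order x^0.08, which outgrows any multiple of log x. The 200 leaves room for
rounding. -/
lemma eventually_exp_le :
    ∀ᶠ x : ℝ in atTop, Real.exp (-(x / 200 / (8 * (x ^ (0.46 : ℝ) + 1) ^ 2))) ≤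
      x ^ (-1.46 : ℝ) := by
  filter_upwards [eventually_log_le_rpow (by norm_num : (0 : ℝ) < 1 / 10000)
    (by norm_num : (0 : ℝ) < 0.08), eventually_ge_atTop 1] with x hx hx1
  have hx0 : 0 < x := by linarith
  rw [Real.rpow_def_of_pos hx0 (-1.46)]
  refine Real.exp_le_exp.2 ?_
  have h1 : 1 ≤ x ^ (0.46 : ℝ) := Real.one_le_rpow hx1 (by norm_num)
  have h2 : (x ^ (0.46 : ℝ) + 1) ^ 2 ≤ 4 * x ^ (0.92 : ℝ) := by
    have : x ^ (0.92 : ℝ) = (x ^ (0.46 : ℝ)) ^ 2 := by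
      rw [← Real.rpow_natCast, ← Real.rpow_mul hx0.le]; norm_num
    rw [this]
    nlinarith
  have h3 : x = x ^ (0.08 : ℝ) * x ^ (0.92 : ℝ) := by
    rw [← Real.rpow_add hx0]; norm_num
  have h4 : x ^ (0.08 : ℝ) / 6400 ≤ x / 200 / (8 * (x ^ (0.46 : ℝ) + 1) ^ 2) := by
    rw [le_div_iff₀ (by positivity)]
    have h5 : 0 ≤ x ^ (0.08 : ℝ) := by positivity
    calc x ^ (0.08 : ℝ) / 6400 * (8 * (x ^ (0.46 : ℝ) + 1) ^ 2)
        ≤ x ^ (0.08 : ℝ) / 6400 * (8 * (4 * x ^ (0.92 : ℝ))) := by gcongr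
      _ = x ^ (0.08 : ℝ) * x ^ (0.92 : ℝ) / 200 := by ring
      _ = x / 200 := by rw [← h3]
  have h5 : 0 ≤ x ^ (0.08 : ℝ) := by positivity
  nlinarith

lemma eventually_le_rpow (c : ℝ) {r : ℝ} (hr : 0 < r) : ∀ᶠ x : ℝ in atTop, c ≤ x ^ r :=
  (tendsto_rpow_atTop hr).eventually_ge_atTop c

/-- The step-size parameter in Halász's inequality. -/
noncomputable def halaszScale (n : ℕ) : ℕ := ⌈(n : ℝ) ^ (0.46 : ℝ)⌉₊

lemma eventually_signProb_le : ∀ᶠ n : ℕ in atTop, ∀ v : Fin n → ℤ, n / 50 < suppCard v →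
    signProb v ≤ (n : ℝ) ^ (-0.45 : ℝ) := by
  classical
  filter_upwards [tendsto_natCast_atTop_atTop.eventually eventually_exp_le,
    tendsto_natCast_atTop_atTop.eventually (eventually_le_rpow 2 (by norm_num : (0 : ℝ) < 0.01)),
    eventually_ge_atTop 1] with n hexp h2 hn v hv
  have hx1 : (1 : ℝ) ≤ n := by exact_mod_cast hn
  have hx0 : (0 : ℝ) < n := by linarith
  have hpos : 0 < (n : ℝ) ^ (0.46 : ℝ) := by positivity
  have hm0 : 0 < halaszScale n := Nat.ceil_pos.2 hpos
  have hm1 : (n : ℝ) ^ (0.46 : ℝ) ≤ halaszScale n := Nat.le_ceil _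
  have hm2 : (halaszScale n : ℝ) ≤ (n : ℝ) ^ (0.46 : ℝ) + 1 := (Nat.ceil_lt_add_one hpos.le).le
  have hT : (Finset.univ.filter fun i => v i ≠ 0).card = suppCard v := by
    unfold suppCard; congr
  have h1 := signProb_int_le v (T := Finset.univ.filter fun i => v i ≠ 0)
    (Finset.card_pos.1 (by omega)) (fun j hj => (Finset.mem_filter.1 hj).2) hm0
  have h3 : (n : ℝ) / 200 ≤ suppCard v := by
    have h4 : n ≤ 50 * suppCard v := by omega
    have h5 : (n : ℝ) ≤ 50 * suppCard v := by exact_mod_cast h4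
    linarith
  rw [hT] at h1
  have hm' : (0 : ℝ) < halaszScale n := by exact_mod_cast hm0
  refine h1.trans ?_
  have h4 : Real.exp (-(suppCard v / (8 * (halaszScale n : ℝ) ^ 2))) ≤ (n : ℝ) ^ (-0.46 : ℝ) := by
    refine le_trans (Real.exp_le_exp.2 (neg_le_neg ?_))
      (hexp.trans (Real.rpow_le_rpow_of_exponent_le hx1 (by norm_num)))
    gcongr
  have h5 : 1 / (halaszScale n : ℝ) ≤ (n : ℝ) ^ (-0.46 : ℝ) := by
    rw [Real.rpow_neg hx0.le, one_div]
    gcongr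
  have h6 : (n : ℝ) ^ (-0.45 : ℝ) = n ^ (0.01 : ℝ) * n ^ (-0.46 : ℝ) := by
    rw [← Real.rpow_add hx0]; norm_num
  rw [h6]
  have h7 : 0 ≤ (n : ℝ) ^ (-0.46 : ℝ) := by positivity
  nlinarith

/-- The terms of Halász's bound total at most (1 + 1 + 800) n^(-1.46), absorbed by n^0.01. The term
1/p is small enough because Littlewood–Offord forces p ≥ n^1.47. -/
lemma eventually_lazyProb_le : ∀ᶠ n : ℕ in atTop, ∀ (p : ℕ) [Fact p.Prime], p ≠ 2 →
    (n : ℝ) ^ (1.02 : ℝ) / (n : ℝ) ^ (-0.45 : ℝ) ≤ p → ∀ t : Fin (n / 100) → ZMod p,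
      Function.Injective t → walkProb (lazyStep (ZMod p)) t ≤ (n : ℝ) ^ (-1.45 : ℝ) := by
  filter_upwards [tendsto_natCast_atTop_atTop.eventually eventually_exp_le,
    tendsto_natCast_atTop_atTop.eventually (eventually_le_rpow 802 (by norm_num : (0 : ℝ) < 0.01)),
    eventually_ge_atTop 1000] with n hexp h802 hn p _ hp2 hp t ht
  have hx1 : (1000 : ℝ) ≤ n := by exact_mod_cast hn
  have hx0 : (0 : ℝ) < n := by linarith
  have hpos : 0 < (n : ℝ) ^ (0.46 : ℝ) := by positivity
  have hm0 : 0 < halaszScale n := Nat.ceil_pos.2 hpos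
  have hm1 : (n : ℝ) ^ (0.46 : ℝ) ≤ halaszScale n := Nat.le_ceil _
  have hm2 : (halaszScale n : ℝ) ≤ (n : ℝ) ^ (0.46 : ℝ) + 1 := (Nat.ceil_lt_add_one hpos.le).le
  have hm' : (0 : ℝ) < halaszScale n := by exact_mod_cast hm0
  have h1 := lazyProb_le_of_injective hp2 ht (by rw [Fintype.card_fin]; omega) hm0
  rw [Fintype.card_fin] at h1
  have h3 : (n : ℝ) / 200 ≤ (n / 100 : ℕ) := by
    have h4 : n ≤ 200 * (n / 100) := by omega
    have h5 : (n : ℝ) ≤ 200 * (n / 100 : ℕ) := by exact_mod_cast h4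
    linarith
  have hk0 : (0 : ℝ) < (n / 100 : ℕ) := by linarith
  refine h1.trans ?_
  have h4 : Real.exp (-((n / 100 : ℕ) / (8 * (halaszScale n : ℝ) ^ 2))) ≤
      (n : ℝ) ^ (-1.46 : ℝ) := by
    refine le_trans (Real.exp_le_exp.2 (neg_le_neg ?_)) hexp
    gcongr
  have h5 : 1 / (p : ℝ) ≤ (n : ℝ) ^ (-1.46 : ℝ) := by
    rw [← Real.rpow_sub hx0] at hp
    calc 1 / (p : ℝ) ≤ 1 / (n : ℝ) ^ (1.02 - -0.45 : ℝ) := by gcongr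
      _ = (n : ℝ) ^ (-(1.02 - -0.45) : ℝ) := by rw [Real.rpow_neg hx0.le, one_div]
      _ ≤ (n : ℝ) ^ (-1.46 : ℝ) :=
          Real.rpow_le_rpow_of_exponent_le (by linarith) (by norm_num)
  have h6 : 4 / ((n / 100 : ℕ) * (halaszScale n : ℝ)) ≤ 800 * (n : ℝ) ^ (-1.46 : ℝ) := by
    calc 4 / ((n / 100 : ℕ) * (halaszScale n : ℝ)) ≤ 4 / ((n : ℝ) / 200 * n ^ (0.46 : ℝ)) := by
          gcongr
      _ = 800 * (n : ℝ) ^ (-1.46 : ℝ) := by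
          rw [show (-1.46 : ℝ) = -(1 + 0.46) by norm_num, Real.rpow_neg hx0.le,
            Real.rpow_add hx0, Real.rpow_one]
          field_simp
          norm_num
  have h7 : (n : ℝ) ^ (-1.45 : ℝ) = n ^ (0.01 : ℝ) * n ^ (-1.46 : ℝ) := by
    rw [← Real.rpow_add hx0]; norm_num
  rw [h7]
  have h8 : 0 ≤ (n : ℝ) ^ (-1.46 : ℝ) := by positivity
  nlinarith

lemma eventually_pow_mul_pow_le (k : ℕ) {r c : ℝ} (hr0 : 0 ≤ r) (hr : r < 1) (hc : 0 < c) :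
    ∀ᶠ n : ℕ in atTop, (n : ℝ) ^ k * r ^ n ≤ c :=
  (tendsto_pow_const_mul_const_pow_of_abs_lt_one k (by rwa [abs_of_nonneg hr0])).eventually_le_const
    hc

lemma rpow_le_sq {x r : ℝ} (hx : 1 ≤ x) (hr : r ≤ 2) : x ^ r ≤ x ^ 2 := by
  rw [← Real.rpow_natCast]
  exact Real.rpow_le_rpow_of_exponent_le hx (by exact_mod_cast hr)

/-- Holds because (3/4)^(1/4) < 0.931 < 15/16, a constraint on how small the cutoff base may be. -/
lemma eventually_prime_range_le : ∀ᶠ n : ℕ in atTop,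
    4 * (n : ℝ) ^ (1.02 : ℝ) / (15 / 16) ^ n * (3 / 4) ^ (n / 4) ≤ 1 := by
  filter_upwards [eventually_pow_mul_pow_le 2 (by norm_num : (0 : ℝ) ≤ 0.931 * (16 / 15))
    (by norm_num) (by norm_num : (0 : ℝ) < 0.931 ^ 3 / 4), eventually_ge_atTop 1] with n hn hn1
  have hx1 : (1 : ℝ) ≤ n := by exact_mod_cast hn1
  have h1 : (3 / 4 : ℝ) ^ (n / 4) ≤ 0.931 ^ n / 0.931 ^ 3 := by
    rw [le_div_iff₀ (by positivity)]
    calc (3 / 4 : ℝ) ^ (n / 4) * 0.931 ^ 3 ≤ (0.931 ^ 4) ^ (n / 4) * 0.931 ^ 3 := by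
          gcongr
          norm_num
      _ = 0.931 ^ (4 * (n / 4) + 3) := by rw [← pow_mul, ← pow_add]
      _ ≤ 0.931 ^ n := pow_le_pow_of_le_one (by norm_num) (by norm_num) (by omega)
  have h2 : (1 : ℝ) / (15 / 16) ^ n = (16 / 15) ^ n := by
    rw [← one_div_pow]; norm_num
  calc 4 * (n : ℝ) ^ (1.02 : ℝ) / (15 / 16) ^ n * (3 / 4) ^ (n / 4)
      = 4 * (n : ℝ) ^ (1.02 : ℝ) * (16 / 15) ^ n * (3 / 4) ^ (n / 4) := by
        rw [← h2]; ring
    _ ≤ 4 * (n : ℝ) ^ 2 * (16 / 15) ^ n * (0.931 ^ n / 0.931 ^ 3) := by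
        gcongr
        exact rpow_le_sq hx1 (by norm_num)
    _ = 4 / 0.931 ^ 3 * ((n : ℝ) ^ 2 * (0.931 * (16 / 15)) ^ n) := by
        rw [mul_pow]; ring
    _ ≤ 4 / 0.931 ^ 3 * (0.931 ^ 3 / 4) := by gcongr
    _ = 1 := by norm_num

/-- Per row the power of n is 1.02 - 1.45 · 0.73 = -0.0385, so n^(-0.0385n) absorbs every
exponential factor. -/
lemma eventually_concentrated_le : ∀ᶠ n : ℕ in atTop,
    4 * (n : ℝ) ^ (1.02 : ℝ) / (15 / 16) ^ n * (4 * (n : ℝ) ^ (1.02 : ℝ) / (15 / 16) ^ n *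
      (2 ^ n * ((n : ℝ) ^ (-1.45 : ℝ)) ^ (73 * n / 100)) * (8 * (n : ℝ) ^ (1.02 : ℝ)) ^ (n - 1)) ≤
      (15 / 16) ^ n := by
  filter_upwards [eventually_pow_mul_pow_le 6 (by norm_num : (0 : ℝ) ≤ 8 / 15)
    (by norm_num) (by norm_num : (0 : ℝ) < 1 / 16),
    tendsto_natCast_atTop_atTop.eventually
      (eventually_le_rpow 40 (by norm_num : (0 : ℝ) < 0.0385)),
    eventually_ge_atTop 1] with n hn h40 hn1
  have hx1 : (1 : ℝ) ≤ n := by exact_mod_cast hn1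
  have hx0 : (0 : ℝ) < n := by linarith
  set x : ℝ := (n : ℝ)
  have hQ : x ^ (1.02 : ℝ) ≤ x ^ 2 := rpow_le_sq hx1 (by norm_num)
  have hQ1 : 1 ≤ x ^ (1.02 : ℝ) := Real.one_le_rpow hx1 (by norm_num)
  have h2 : (1 : ℝ) / (15 / 16) ^ n = (16 / 15) ^ n := by
    rw [← one_div_pow]; norm_num
  have h3 : (x ^ (-1.45 : ℝ)) ^ (73 * n / 100) * (x ^ (1.02 : ℝ)) ^ n ≤
      x ^ 2 * (x ^ (-0.0385 : ℝ)) ^ n := by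
    simp only [← Real.rpow_natCast, ← Real.rpow_mul hx0.le]
    rw [← Real.rpow_add hx0, ← Real.rpow_add hx0]
    refine Real.rpow_le_rpow_of_exponent_le hx1 ?_
    have h4 : 73 * n ≤ 100 * (73 * n / 100) + 99 := by omega
    have h5 : 73 * (n : ℝ) ≤ 100 * ((73 * n / 100 : ℕ) : ℝ) + 99 := by exact_mod_cast h4
    push_cast
    linarith
  have h6 : x ^ (-0.0385 : ℝ) ≤ 1 / 40 := by
    rw [Real.rpow_neg hx0.le, ← one_div]
    gcongr
  calc 4 * x ^ (1.02 : ℝ) / (15 / 16) ^ n * (4 * x ^ (1.02 : ℝ) / (15 / 16) ^ n *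
      (2 ^ n * (x ^ (-1.45 : ℝ)) ^ (73 * n / 100)) * (8 * x ^ (1.02 : ℝ)) ^ (n - 1))
      = 16 * (x ^ (1.02 : ℝ)) ^ 2 * ((16 / 15) ^ n) ^ 2 *
        (2 ^ n * (x ^ (-1.45 : ℝ)) ^ (73 * n / 100)) * (8 * x ^ (1.02 : ℝ)) ^ (n - 1) := by
        rw [← h2]; ring
    _ ≤ 16 * (x ^ 2) ^ 2 * ((16 / 15) ^ n) ^ 2 *
        (2 ^ n * (x ^ (-1.45 : ℝ)) ^ (73 * n / 100)) * (8 * x ^ (1.02 : ℝ)) ^ n := by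
        gcongr
        · linarith
        · omega
    _ = 16 * x ^ 4 * ((16 / 15) ^ 2 * 2 * 8) ^ n *
        ((x ^ (-1.45 : ℝ)) ^ (73 * n / 100) * (x ^ (1.02 : ℝ)) ^ n) := by
        simp only [mul_pow, ← pow_mul, mul_comm 2 n]
        ring
    _ ≤ 16 * x ^ 4 * ((16 / 15) ^ 2 * 2 * 8) ^ n * (x ^ 2 * (1 / 40) ^ n) := by
        refine mul_le_mul_of_nonneg_left (h3.trans ?_) (by positivity)
        gcongr
    _ = 16 * x ^ 6 * ((16 / 15) ^ 2 * 2 * 8 * (1 / 40)) ^ n := by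
        rw [mul_pow _ (1 / 40 : ℝ)]; ring
    _ ≤ 16 * x ^ 6 * (8 / 15 * (15 / 16)) ^ n :=
        mul_le_mul_of_nonneg_left (pow_le_pow_left₀ (by norm_num) (by norm_num) n) (by positivity)
    _ = 16 * (x ^ 6 * (8 / 15) ^ n) * (15 / 16) ^ n := by rw [mul_pow]; ring
    _ ≤ 16 * (1 / 16) * (15 / 16) ^ n := by gcongr
    _ = (15 / 16) ^ n := by ring

/-- Numerically 50^(1/50) < 1.09 and 1.04 · 1.09 / 2 < 0.6. -/
lemma eventually_sparse_le : ∀ᶠ n : ℕ in atTop,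
    (1 / 2 : ℝ) ^ (n - 1) * ((1 + 2 * (1 / 50)) ^ n / (1 / 50) ^ (n / 50)) ≤ (15 / 16) ^ n := by
  filter_upwards [eventually_pow_mul_pow_le 0 (by norm_num : (0 : ℝ) ≤ 0.6 * (16 / 15))
    (by norm_num) (by norm_num : (0 : ℝ) < 1 / 2), eventually_ge_atTop 1] with n hn hn1
  rw [pow_zero, one_mul] at hn
  have h1 : (1 : ℝ) / (1 / 50) ^ (n / 50) ≤ 1.09 ^ n := by
    rw [← one_div_pow, one_div_one_div]
    calc (50 : ℝ) ^ (n / 50) ≤ (1.09 ^ 50) ^ (n / 50) := by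
          gcongr
          norm_num
      _ = 1.09 ^ (50 * (n / 50)) := by rw [← pow_mul]
      _ ≤ 1.09 ^ n := pow_le_pow_right₀ (by norm_num) (by omega)
  have h2 : (1 / 2 : ℝ) ^ (n - 1) = 2 * (1 / 2) ^ n := by
    obtain ⟨m, rfl⟩ : ∃ m, n = m + 1 := ⟨n - 1, by omega⟩
    rw [Nat.add_sub_cancel, pow_succ]
    ring
  calc (1 / 2 : ℝ) ^ (n - 1) * ((1 + 2 * (1 / 50)) ^ n / (1 / 50) ^ (n / 50))
      = 2 * (1 / 2) ^ n * (1 + 2 * (1 / 50)) ^ n * (1 / (1 / 50) ^ (n / 50)) := by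
        rw [h2]; ring
    _ ≤ 2 * (1 / 2) ^ n * (1 + 2 * (1 / 50)) ^ n * 1.09 ^ n := by gcongr
    _ = 2 * (1 / 2 * (1 + 2 * (1 / 50)) * 1.09) ^ n := by simp only [mul_pow]; ring
    _ ≤ 2 * (0.6 * (16 / 15) * (15 / 16)) ^ n :=
        mul_le_mul_of_nonneg_left (pow_le_pow_left₀ (by norm_num) (by norm_num) n) (by norm_num)
    _ = 2 * (0.6 * (16 / 15)) ^ n * (15 / 16) ^ n := by rw [mul_pow _ (15 / 16 : ℝ)]; ring
    _ ≤ 2 * (1 / 2) * (15 / 16) ^ n := by gcongr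
    _ = (15 / 16) ^ n := by ring

/-- The singularity probability is at most `0.938 ^ n` for large `n`. -/
theorem eventually_singularProb_le : ∀ᶠ n : ℕ in atTop, singularProb n ≤ 0.938 ^ n := by
  obtain ⟨x₀, hx₀⟩ := eventually_atTop.1 eventually_le_theta_sub
  filter_upwards [eventually_signProb_le, eventually_lazyProb_le, eventually_prime_range_le,
    eventually_concentrated_le, eventually_sparse_le,
    tendsto_natCast_atTop_atTop.eventually (eventually_le_rpow x₀ (by norm_num : (0 : ℝ) < 1.02)),
    tendsto_natCast_atTop_atTop.eventually
      (eventually_log_le_rpow one_pos (by norm_num : (0 : ℝ) < 0.02)),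
    eventually_pow_mul_pow_le 1 (by norm_num : (0 : ℝ) ≤ 15 / 16 / 0.938)
    (by norm_num) (by norm_num : (0 : ℝ) < 1 / 3),
    eventually_ge_atTop 1000] with n hLO hβ hm₁ hconc hsparse hθ hlog hfin hn
  obtain ⟨N, rfl⟩ : ∃ N, n = N + 1 := ⟨n - 1, by omega⟩
  have hx1 : (1000 : ℝ) ≤ (N + 1 : ℕ) := by exact_mod_cast hn
  have hx0 : (0 : ℝ) < (N + 1 : ℕ) := by linarith
  have hQ : ((N + 1 : ℕ) : ℝ) ≤ ((N + 1 : ℕ) : ℝ) ^ (1.02 : ℝ) := by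
    simpa using Real.rpow_le_rpow_of_exponent_le (by linarith : (1 : ℝ) ≤ (N + 1 : ℕ))
      (by norm_num : (1 : ℝ) ≤ 1.02)
  have hk : (((N + 1) / 100 : ℕ) : ℝ) + 1 ≤ (N + 1 : ℕ) := by
    exact_mod_cast (by omega : (N + 1) / 100 + 1 ≤ N + 1)
  have hlogQ : Real.log (((N : ℝ) + 1) ^ (N + 1)) ≤ ((N + 1 : ℕ) : ℝ) ^ (1.02 : ℝ) := by
    rw [← Nat.cast_add_one, Real.log_pow]
    calc ((N + 1 : ℕ) : ℝ) * Real.log (N + 1 : ℕ)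
        ≤ (N + 1 : ℕ) * (1 * ((N + 1 : ℕ) : ℝ) ^ (0.02 : ℝ)) := by gcongr
      _ = ((N + 1 : ℕ) : ℝ) ^ (1.02 : ℝ) := by
          rw [one_mul, show (1.02 : ℝ) = 1 + 0.02 by norm_num, Real.rpow_add hx0, Real.rpow_one]
  -- The row budget is 1/4 + 73/100 + 1/100 < 1.
  have main := singularProb_succ_le (N := N) (k := (N + 1) / 100) (m₁ := (N + 1) / 4)
    (m₂ := 73 * (N + 1) / 100) (s := (N + 1) / 50) (Q := ((N + 1 : ℕ) : ℝ) ^ (1.02 : ℝ))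
    (q₀ := (15 / 16) ^ (N + 1)) (by omega) (by positivity) hLO (by linarith) (by omega)
    (by linarith) hlogQ (fun x hx => hx₀ x (hθ.trans hx)) (by positivity)
    (Real.rpow_le_one_of_one_le_of_nonpos (by linarith) (by norm_num)) hβ (by omega) hm₁
  refine main.trans ?_
  rw [Nat.add_sub_cancel] at hsparse hconc
  rw [pow_one, div_pow, mul_div_assoc', div_le_iff₀ (by positivity)] at hfin
  calc ((N : ℝ) + 1) * _ ≤ (N + 1 : ℕ) * ((15 / 16) ^ (N + 1) + (15 / 16) ^ (N + 1) +
        (15 / 16) ^ (N + 1)) := by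
        rw [← Nat.cast_add_one]
        gcongr
    _ ≤ _ := by linarith

end Asymptotics

/-! ### Numerical location of ε -/

section Entropy

lemma entropy_eq (x : ℝ) : entropy x = Real.binEntropy x / Real.log 2 := by
  simp only [entropy, Real.binEntropy, Real.logb, one_div]
  ring

/-- The left-hand side of the equation defining the exponent. -/
noncomputable def entropyLHS (x : ℝ) : ℝ := entropy x + x / Real.logb 2 (16 / 15)

lemma entropyLHS_eq (x : ℝ) :
    entropyLHS x = Real.binEntropy x / Real.log 2 + x * Real.log 2 / Real.log (16 / 15) := by
  rw [entropyLHS, entropy_eq, Real.logb, div_div_eq_mul_div]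

lemma continuous_entropyLHS : Continuous entropyLHS := by
  have h : entropyLHS = fun x =>
      Real.binEntropy x / Real.log 2 + x * Real.log 2 / Real.log (16 / 15) := funext entropyLHS_eq
  rw [h]
  have := Real.binEntropy_continuous
  fun_prop

lemma strictMonoOn_entropyLHS : StrictMonoOn entropyLHS (Set.Icc 0 2⁻¹) := by
  intro x hx y hy hxy
  have h1 := Real.binEntropy_strictMonoOn hx hy hxy
  have h2 : 0 < Real.log 2 := Real.log_pos (by norm_num)
  have h3 : 0 < Real.log (16 / 15) := Real.log_pos (by norm_num)
  rw [entropyLHS_eq, entropyLHS_eq]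
  gcongr

lemma abs_log_sixteen_div_fifteen : |Real.log (16 / 15) - 0.06453852| ≤ 1e-7 := by
  have h := Real.abs_log_sub_add_sum_range_le (x := 1 / 16) (by norm_num [abs_of_pos]) 5
  have h1 : Real.log (16 / 15) = -Real.log (1 - 1 / 16) := by
    rw [← Real.log_inv]; norm_num
  rw [h1]
  simp only [Finset.sum_range_succ, Finset.sum_range_zero] at h
  norm_num [abs_le] at h ⊢
  constructor <;> linarith [h.1, h.2]

/-- For x near 1/16 the argument 1 - 16x is tiny, so a few terms of the logarithm series suffice. -/
lemma binEntropy_eq_sub (x : ℝ) (hx : 0 < x) : Real.binEntropy x =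
    x * (4 * Real.log 2 - Real.log (1 - (1 - 16 * x))) - (1 - x) * Real.log (1 - x) := by
  have h : Real.log (1 - (1 - 16 * x)) = 4 * Real.log 2 + Real.log x := by
    rw [show (1 : ℝ) - (1 - 16 * x) = 2 ^ 4 * x by ring, Real.log_mul (by norm_num) hx.ne',
      Real.log_pow]
    norm_num
  rw [h, Real.binEntropy, Real.log_inv, Real.log_inv]
  ring

lemma entropyLHS_lower : entropyLHS 0.06191 < 1 := by
  have h1 := Real.abs_log_sub_add_sum_range_le (x := 0.06191) (by norm_num [abs_of_pos]) 5
  have h2 := Real.abs_log_sub_add_sum_range_le (x := 1 - 16 * 0.06191)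
    (by norm_num [abs_of_pos]) 3
  have h3 := abs_le.1 abs_log_sixteen_div_fifteen
  have h4 := Real.log_two_gt_d9
  have h5 := Real.log_two_lt_d9
  have hA : Real.binEntropy 0.06191 ≤ 0.232192 := by
    rw [binEntropy_eq_sub _ (by norm_num)]
    simp only [Finset.sum_range_succ, Finset.sum_range_zero] at h1 h2
    norm_num [abs_le] at h1 h2 ⊢
    linarith [h1.1, h1.2, h2.1, h2.2]
  rw [entropyLHS_eq]
  calc Real.binEntropy 0.06191 / Real.log 2 + 0.06191 * Real.log 2 / Real.log (16 / 15)
      ≤ 0.232192 / 0.6931471803 + 0.06191 * 0.6931471808 / (0.06453852 - 1e-7) := by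
        gcongr
        linarith
    _ < 1 := by norm_num

lemma entropyLHS_upper : 1 < entropyLHS 0.06192 := by
  have h1 := Real.abs_log_sub_add_sum_range_le (x := 0.06192) (by norm_num [abs_of_pos]) 5
  have h2 := Real.abs_log_sub_add_sum_range_le (x := 1 - 16 * 0.06192)
    (by norm_num [abs_of_pos]) 3
  have h3 := abs_le.1 abs_log_sixteen_div_fifteen
  have h4 := Real.log_two_gt_d9
  have h5 := Real.log_two_lt_d9
  have hA : 0.232217 ≤ Real.binEntropy 0.06192 := by
    rw [binEntropy_eq_sub _ (by norm_num)]
    simp only [Finset.sum_range_succ, Finset.sum_range_zero] at h1 h2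
    norm_num [abs_le] at h1 h2 ⊢
    linarith [h1.1, h1.2, h2.1, h2.2]
  rw [entropyLHS_eq]
  have hpos : 0 < Real.log (16 / 15) := Real.log_pos (by norm_num)
  calc (1 : ℝ) < 0.232217 / 0.6931471808 + 0.06192 * 0.6931471803 / (0.06453852 + 1e-7) := by
        norm_num
    _ ≤ Real.binEntropy 0.06192 / Real.log 2 + 0.06192 * Real.log 2 / Real.log (16 / 15) := by
        gcongr
        linarith

end Entropy

theorem theorem1p5 :
    ∃ ε : ℝ, IsEntropySolution ε ∧ (∀ x : ℝ, IsEntropySolution x → x = ε) ∧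
      0.06191 ≤ ε ∧ ε < 0.06192 ∧
      (∃ o : ℕ → ℝ, Tendsto o atTop (𝓝 0) ∧
        ∀ n : ℕ, singularProb n ≤ (1 - ε + o n) ^ n) ∧
      (∀ᶠ n : ℕ in atTop, singularProb n ≤ (0.939 : ℝ) ^ n) := by
  classical
  obtain ⟨ε, ⟨hε1, hε2⟩, hε⟩ := intermediate_value_Ioo (by norm_num : (0.06191 : ℝ) ≤ 0.06192)
    continuous_entropyLHS.continuousOn ⟨entropyLHS_lower, entropyLHS_upper⟩
  have hev : ∀ᶠ n : ℕ in atTop, singularProb n ≤ (1 - ε) ^ n := by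
    filter_upwards [eventually_singularProb_le] with n hn
    exact hn.trans (pow_le_pow_left₀ (by norm_num) (by linarith) n)
  -- At the finitely many n where the bound fails, the error term ε makes the base 1.
  refine ⟨ε, ⟨by linarith, by linarith, hε⟩, ?_, hε1.le, hε2,
    ⟨fun n => if singularProb n ≤ (1 - ε) ^ n then 0 else ε, ?_, fun n => ?_⟩, ?_⟩
  · rintro x ⟨hx0, hx1, hx⟩
    refine strictMonoOn_entropyLHS.injOn ⟨hx0.le, by linarith⟩ ⟨by linarith, by linarith⟩ ?_
    exact Eq.trans hx hε.symm
  · refine tendsto_const_nhds.congr' ?_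
    filter_upwards [hev] with n hn
    rw [if_pos hn]
  · dsimp only
    split_ifs with h
    · rwa [add_zero]
    · rw [sub_add_cancel, one_pow]
      exact MeasureTheory.measureReal_le_one
  · filter_upwards [eventually_singularProb_le] with n hn
    exact hn.trans (pow_le_pow_left₀ (by norm_num) (by norm_num) n)
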